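/- Let $\mathbb{O}$ be the real octonions (the Cayley–Dickson double of the quaternions), let $\mathbf{H}_n(\mathbb{O})$ be the real vector space of octonionic Hermitian $n\times n$ matrices, and call the elements of $\mathbf{H}_3(\mathbb{O})$ Jordan matrices. For Jordan matrices put $$\mathcal{X}\circ\mathcal{Y}=\tfrac12(\mathcal{X}\mathcal{Y}+\mathcal{Y}\mathcal{X}),\qquad \mathcal{X}*\mathcal{Y}=\mathcal{X}\circ\mathcal{Y}-\tfrac12\bigl(\mathcal{X}\,\mathrm{tr}\,\mathcal{Y}+\mathcal{Y}\,\mathrm{tr}\,\mathcal{X}\bigr)-\tfrac12\bigl(\mathrm{tr}(\mathcal{X}\circ\mathcal{Y})-\mathrm{tr}\,\mathcal{X}\,\mathrm{tr}\,\mathcal{Y}\bigr)\mathcal{I},$$ $$\det\mathcal{X}=\tfrac13\mathrm{tr}\bigl((\mathcal{X}*\mathcal{X})\circ\mathcal{X}\bigr),\qquad \sigma(\mathcal{X})=\mathrm{tr}(\mathcal{X}*\mathcal{X}).$$ Let $E_6$ (in the real form $E_{6(-26)}$) be the group of all real-linear automorphisms of $\mathbf{H}_3(\mathbb{O})$ that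 preserve $\det$. A primitive idempotent is a Jordan matrix $\mathcal{P}\neq0$ with $\mathcal{P}\circ\mathcal{P}=\mathcal{P}$ that is not the sum of two nonzero idempotents whose Jordan product is $0$. A Jordan matrix $\mathcal{A}$ is a $p$-square if $\mathcal{A}=\sum_{i=1}^3\lambda_i\mathcal{P}_i$ with $\lambda_i\in\mathbb{R}$, primitive idempotents $\mathcal{P}_i$ with $\mathcal{P}_i\circ\mathcal{P}_j=0$ for $i\ne j$, and exactly $p$ of the $\lambda_i$ nonzero. 1. Let $\mathcal{M}$ be a complex octonionic $3\times3$ matrix (all entries in one subalgebra $\mathbb{R}\oplus\mathbb{R}s$, $s^2=-1$) with $\det\mathcal{M}=\pm1$. Then $\mathcal{M}(\mathcal{X}\mathcal{M}^\dagger)=(\mathcal{M}\mathcal{X})\mathcal{M}^\dagger$ for every Jordan matrix $\mathcal{X}$, and $\mathcal{X}\mapsto\mathcal{M}\mathcal{X}\mathcal{M}^\dagger$ is a linear automorphism of $\mathbf{H}_3(\mathbb{O})$. The group $TSL(3;\mathbb{O})$ generated by these maps is contained in $E_6$; that is, all of its elements preserve the determinant. 2. Every $T\in E_6$ preserves the determinant,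 and, among Jordan matrices with $\det\mathcal{A}=0$, the condition $\sigma(\mathcal{A})=0$: if $\det\mathcal{A}=0$, then $\sigma(T\mathcal{A})=0$ if and only if $\sigma(\mathcal{A})=0$. For every $p$ and every Jordan matrix $\mathcal{A}$, $T\mathcal{A}$ is a $p$-square if and only if $\mathcal{A}$ is a $p$-square. 3. A Jordan matrix $\mathcal{P}$ is a $1$-square if and only if $\mathcal{P}\neq0$ and $\mathcal{P}*\mathcal{P}=0$. For every $T\in E_6$, $(T\mathcal{P})*(T\mathcal{P})=0$ if and only if $\mathcal{P}*\mathcal{P}=0$. Thus $E_6$ is a symmetry group of the equation $\mathcal{P}*\mathcal{P}=0$. This equation expresses the massless Dirac equation in 10 spacetime dimensions: for $0\ne P\in\mathbf{H}_2(\mathbb{O})$ and $0\ne\psi\in\mathbb{O}^2$, with $\tilde P=P-\mathrm{tr}(P)I$, one has $\tilde P\psi=0$ if and only if there is $n\in\mathbb{R}$ such that $\mathcal{P}=\begin{pmatrix}P&\psi\\ \psi^\dagger&n\end{pmatrix}$ satisfies $\mathcal{P}*\mathcal{P}=0$. -/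

import Mathlib

open scoped Quaternion Matrix

noncomputable section

/-- The real octonions, as the Cayley–Dickson double of Hamilton's quaternions. -/
@[ext]
structure Octonion where
  fst : ℍ[ℝ]
  snd : ℍ[ℝ]

namespace Octonion

instance : Zero Octonion := ⟨⟨0, 0⟩⟩
instance : One Octonion := ⟨⟨1, 0⟩⟩
instance : Add Octonion := ⟨fun x y => ⟨x.fst + y.fst, x.snd + y.snd⟩⟩
instance : Neg Octonion := ⟨fun x => ⟨-x.fst, -x.snd⟩⟩
instance : Sub Octonion := ⟨fun x y => ⟨x.fst - y.fst, x.snd - y.snd⟩⟩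
instance : SMul ℕ Octonion := ⟨fun r x => ⟨r • x.fst, r • x.snd⟩⟩
instance : SMul ℤ Octonion := ⟨fun r x => ⟨r • x.fst, r • x.snd⟩⟩
instance : SMul ℝ Octonion := ⟨fun r x => ⟨r • x.fst, r • x.snd⟩⟩

/-- The Cayley–Dickson product `(a, b) (c, d) = (a c - d̄ b, d a + b c̄)`. -/
instance : Mul Octonion :=
  ⟨fun x y => ⟨x.fst * y.fst - star y.snd * x.snd, y.snd * x.fst + x.snd * star y.fst⟩⟩

/-- Octonionic conjugation `(a, b) ↦ (ā, -b)`. -/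
instance : Star Octonion := ⟨fun x => ⟨star x.fst, -x.snd⟩⟩

@[simp] theorem fst_zero : (0 : Octonion).fst = 0 := rfl
@[simp] theorem snd_zero : (0 : Octonion).snd = 0 := rfl
@[simp] theorem fst_one : (1 : Octonion).fst = 1 := rfl
@[simp] theorem snd_one : (1 : Octonion).snd = 0 := rfl
@[simp] theorem fst_add (x y : Octonion) : (x + y).fst = x.fst + y.fst := rfl
@[simp] theorem snd_add (x y : Octonion) : (x + y).snd = x.snd + y.snd := rfl
@[simp] theorem fst_neg (x : Octonion) : (-x).fst = -x.fst := rfl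
@[simp] theorem snd_neg (x : Octonion) : (-x).snd = -x.snd := rfl
@[simp] theorem fst_sub (x y : Octonion) : (x - y).fst = x.fst - y.fst := rfl
@[simp] theorem snd_sub (x y : Octonion) : (x - y).snd = x.snd - y.snd := rfl
@[simp] theorem fst_smul (r : ℝ) (x : Octonion) : (r • x).fst = r • x.fst := rfl
@[simp] theorem snd_smul (r : ℝ) (x : Octonion) : (r • x).snd = r • x.snd := rfl
@[simp] theorem fst_mul (x y : Octonion) :
    (x * y).fst = x.fst * y.fst - star y.snd * x.snd := rfl
@[simp] theorem snd_mul (x y : Octonion) :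
    (x * y).snd = y.snd * x.fst + x.snd * star y.fst := rfl
@[simp] theorem fst_star (x : Octonion) : (star x).fst = star x.fst := rfl
@[simp] theorem snd_star (x : Octonion) : (star x).snd = -x.snd := rfl

/-- The underlying pair of quaternions. -/
def toProd (x : Octonion) : ℍ[ℝ] × ℍ[ℝ] := (x.fst, x.snd)

theorem toProd_injective : Function.Injective toProd := fun x y h => by
  have h1 := congrArg Prod.fst h
  have h2 := congrArg Prod.snd h
  exact Octonion.ext h1 h2

instance : AddCommGroup Octonion :=
  toProd_injective.addCommGroup toProd rfl (fun _ _ => rfl) (fun _ => rfl)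
    (fun _ _ => rfl) (fun _ _ => rfl) (fun _ _ => rfl)

instance : NonAssocRing Octonion where
  left_distrib x y z := by ext1 <;> simp [mul_add, add_mul] <;> abel
  right_distrib x y z := by ext1 <;> simp [mul_add, add_mul] <;> abel
  zero_mul x := by ext1 <;> simp
  mul_zero x := by ext1 <;> simp
  one_mul x := by ext1 <;> simp
  mul_one x := by ext1 <;> simp

instance : Module ℝ Octonion where
  one_smul x := by ext1 <;> simp
  mul_smul r s x := by ext1 <;> simp [mul_smul]
  smul_zero r := by ext1 <;> simp
  smul_add r x y := by ext1 <;> simp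
  add_smul r s x := by ext1 <;> simp [add_smul]
  zero_smul x := by ext1 <;> simp

instance : StarRing Octonion where
  star_involutive x := by ext1 <;> simp
  star_mul x y := by ext1 <;> simp
  star_add x y := by ext1 <;> simp [add_comm]

instance : StarModule ℝ Octonion where
  star_smul r x := by ext1 <;> simp

/-- The real part of an octonion. -/
def re (x : Octonion) : ℝ := x.fst.re

/-- For an octonion `s` with `s * s = -1`, the embedding `a + b i ↦ a + b s` of `ℂ` into the
octonions, whose range is a complex subalgebra. -/
def ofComplex (s : Octonion) (z : ℂ) : Octonion := z.re • (1 : Octonion) + z.im • s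

end Octonion

/-- The real vector space `H_n(𝕆)` of octonionic Hermitian `n × n` matrices. -/
def hermitianOctonionMatrices (n : ℕ) : Submodule ℝ (Matrix (Fin n) (Fin n) Octonion) where
  carrier := {X | Xᴴ = X}
  add_mem' {X Y} hX hY := by
    simp only [Set.mem_ofPred_eq] at hX hY ⊢
    rw [Matrix.conjTranspose_add, hX, hY]
  zero_mem' := by simp
  smul_mem' r X hX := by
    simp only [Set.mem_ofPred_eq] at hX ⊢
    rw [Matrix.conjTranspose_smul, hX, star_trivial]

/-- Octonionic Hermitian `2 × 2` matrices (vectors of 10-dimensional spacetime). -/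
abbrev H2 : Type := hermitianOctonionMatrices 2

/-- Jordan matrices: octonionic Hermitian `3 × 3` matrices. -/
abbrev H3 : Type := hermitianOctonionMatrices 3

/-- The trace of an octonionic Hermitian matrix; its diagonal entries are real. -/
def hermTrace {n : ℕ} (X : hermitianOctonionMatrices n) : ℝ :=
  ∑ i, (X.1 i i).re

namespace H3

/-- The identity matrix. -/
def one : H3 := ⟨1, by
  change (1 : Matrix (Fin 3) (Fin 3) Octonion)ᴴ = 1
  exact Matrix.conjTranspose_one⟩

/-- The Jordan product `X ∘ Y = (X Y + Y X) / 2`. -/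
def jordan (X Y : H3) : H3 := ⟨(1 / 2 : ℝ) • (X.1 * Y.1 + Y.1 * X.1), by
  have hX : X.1ᴴ = X.1 := X.2
  have hY : Y.1ᴴ = Y.1 := Y.2
  change ((1 / 2 : ℝ) • (X.1 * Y.1 + Y.1 * X.1))ᴴ = _
  rw [Matrix.conjTranspose_smul, Matrix.conjTranspose_add, Matrix.conjTranspose_mul,
    Matrix.conjTranspose_mul, hX, hY, star_trivial, add_comm]⟩

/-- The Freudenthal product
`X * Y = X ∘ Y - (X tr Y + Y tr X) / 2 - (tr (X ∘ Y) - tr X tr Y) I / 2`. -/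
def freudenthal (X Y : H3) : H3 :=
  jordan X Y - (1 / 2 : ℝ) • (hermTrace Y • X + hermTrace X • Y)
    - ((1 / 2 : ℝ) * (hermTrace (jordan X Y) - hermTrace X * hermTrace Y)) • one

/-- The triple product `[X, Y, Z] = (X * Y) ∘ Z`. -/
def triple (X Y Z : H3) : H3 := jordan (freudenthal X Y) Z

/-- The determinant `det X = tr [X, X, X] / 3`. -/
def det (X : H3) : ℝ := (1 / 3 : ℝ) * hermTrace (triple X X X)

/-- The quadratic invariant `σ(X) = tr (X * X)`. -/
def sigma (X : H3) : ℝ := hermTrace (freudenthal X X)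

/-- A primitive idempotent: a nonzero idempotent of the Jordan algebra that is not the sum of two
nonzero orthogonal idempotents. -/
def IsPrimitiveIdempotent (P : H3) : Prop :=
  P ≠ 0 ∧ jordan P P = P ∧
    ∀ E F : H3, jordan E E = E → jordan F F = F → jordan E F = 0 → P = E + F → E = 0 ∨ F = 0

/-- `A` is a `p`-square: it has a decomposition `A = ∑ λᵢ Pᵢ` into three pairwise orthogonal
primitive idempotents with exactly `p` nonzero (real) eigenvalues `λᵢ`. -/
def IsPSquare (p : ℕ) (A : H3) : Prop :=
  ∃ (lam : Fin 3 → ℝ) (P : Fin 3 → H3),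
    (∀ i, IsPrimitiveIdempotent (P i)) ∧
    (∀ i j, i ≠ j → jordan (P i) (P j) = 0) ∧
    A = ∑ i, lam i • P i ∧
    (Finset.univ.filter fun i => lam i ≠ 0).card = p

/-- The group `E₆` (in the noncompact real form `E₆₍₋₂₆₎`): all real-linear automorphisms of the
space of Jordan matrices that preserve the determinant. -/
def E6 : Subgroup (H3 ≃ₗ[ℝ] H3) where
  carrier := {T | ∀ X, det (T X) = det X}
  mul_mem' {S T} hS hT X := by
    change det (S (T X)) = det X
    rw [hS, hT]
  one_mem' _ := rfl
  inv_mem' {T} hT X := by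
    have h := hT (T.symm X)
    rw [LinearEquiv.apply_symm_apply] at h
    exact h.symm

/-- `M` is a complex matrix (its entries lie in one complex subalgebra of the octonions) with
determinant `1` or `-1`. -/
def IsGenerator (M : Matrix (Fin 3) (Fin 3) Octonion) : Prop :=
  ∃ (s : Octonion) (N : Matrix (Fin 3) (Fin 3) ℂ),
    s * s = -1 ∧ (N.det = 1 ∨ N.det = -1) ∧ M = N.map (Octonion.ofComplex s)

/-- The group `TSL(3; 𝕆)` generated under composition by the transformations `X ↦ M X M†` with `M`
a complex matrix of determinant `±1`. -/
def TSL3 : Subgroup (H3 ≃ₗ[ℝ] H3) :=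
  Subgroup.closure {T | ∃ M, IsGenerator M ∧ ∀ X : H3, (T X).1 = M * X.1 * Mᴴ}

/-- The Jordan matrix with blocks `P`, `ψ`, `ψ†`, `n`. -/
def ofBlocks (P : H2) (ψ : Fin 2 → Octonion) (n : ℝ) : H3 :=
  ⟨!![P.1 0 0, P.1 0 1, ψ 0;
      P.1 1 0, P.1 1 1, ψ 1;
      star (ψ 0), star (ψ 1), n • (1 : Octonion)], by
    have hP : ∀ i j, star (P.1 i j) = P.1 j i := fun i j => by
      have h : P.1ᴴ = P.1 := P.2
      exact congrFun (congrFun h j) i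
    change _ᴴ = _
    ext1 i j
    fin_cases i <;> fin_cases j <;> simp [Matrix.conjTranspose_apply, hP]⟩

end H3

/-- Trace reversal `P̃ = P - tr(P) I`. -/
def traceReversal (P : H2) : Matrix (Fin 2) (Fin 2) Octonion :=
  P.1 - hermTrace P • (1 : Matrix (Fin 2) (Fin 2) Octonion)

end

/-!
A Jordan matrix is written in coordinates `H3.mk a b c x y z`, with real diagonal `a, b, c` and
`X₁₂ = x`, `X₂₃ = y`, `X₃₁ = z`. In these coordinates alternativity, multiplicativity of the norm
and one form of the Moufang identity give the three identities on which everything rests: the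
characteristic equation `(X * X) ∘ X = det X` (`jordan_freudenthal_self`), the adjoint identity
`(X * X) * (X * X) = (det X) X` (`freudenthal_freudenthal_self`), and the symmetry of the trilinear
form `tr ((X * Y) ∘ Z)` (`hermTrace_triple_right_comm`). The trace form is positive definite.

*The generators.* Left and right multiplication by a complex subalgebra are commuting actions of
`ℂ` on the octonions, so `X ↦ N X N†` is a well-defined action of complex matrices. A complex matrix
of determinant `±1` is a product of transvections and `diag (1, 1, ±1)`, and a transvection
preserves the determinant by a direct computation (`det_mk_shear`).

*The action of `E₆`.* The derivative of `det` at `X` is `Y ↦ tr ((X * X) ∘ Y)`. A linear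
automorphism preserving `det` therefore preserves `X * X = 0`, by nondegeneracy of the trace form.
If `det X = 0`, then `Q = X * X` satisfies `Q * Q = 0`, and such a `Q` vanishes once its trace
`σ(X)` does; hence `σ(X) = 0` and `X * X = 0` are equivalent on singular matrices.

*The `p`-squares.* Primitive idempotents are the idempotents of trace one
(`isPrimitiveIdempotent_iff`), and every Jordan matrix is a real combination of three orthogonal
ones (`exists_spectral_decomposition`). For `A = ∑ λᵢ Pᵢ` the adjoint has eigenvalues `λⱼ λₖ`
and the determinant is `λ₁ λ₂ λ₃`, so the conditions `A = 0`, `A * A = 0`, `det A = 0` determine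
the number `p` of nonzero eigenvalues, and all three are invariant under `E₆`.

*The Dirac equation.* Up to conjugation, two of the off-diagonal entries of `𝒫 * 𝒫` are the
components of `P̃ ψ`. Given their vanishing, alternativity forces `det P = 0`, and `n = |ψ|² / tr P`
makes the other entries vanish.
-/

noncomputable section

/-! ### Octonion identities -/

namespace Octonion

instance : IsScalarTower ℝ Octonion Octonion where
  smul_assoc r x y := by ext <;> simp <;> ring

instance : SMulCommClass ℝ Octonion Octonion where
  smul_comm r x y := by ext <;> simp <;> ring

/-- The squared Euclidean norm `x x̄` of an octonion. -/
def normSq (x : Octonion) : ℝ := re (x * star x)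

theorem normSq_def (x : Octonion) : normSq x = re (x * star x) := rfl

theorem normSq_star (x : Octonion) : normSq (star x) = normSq x := by
  simp [normSq, re]

theorem normSq_mul (x y : Octonion) : normSq (x * y) = normSq x * normSq y := by
  simp [normSq, re]; ring

theorem normSq_eq_add (x : Octonion) :
    normSq x = Quaternion.normSq x.fst + Quaternion.normSq x.snd := by
  simp [normSq, re, Quaternion.normSq_def]

theorem normSq_nonneg (x : Octonion) : 0 ≤ normSq x := by
  rw [normSq_eq_add]
  exact add_nonneg Quaternion.normSq_nonneg Quaternion.normSq_nonneg

theorem normSq_eq_zero {x : Octonion} : normSq x = 0 ↔ x = 0 := by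
  rw [normSq_eq_add, add_eq_zero_iff_of_nonneg Quaternion.normSq_nonneg Quaternion.normSq_nonneg,
    Quaternion.normSq_eq_zero, Quaternion.normSq_eq_zero, Octonion.ext_iff]
  rfl

/-- Left alternativity, with the norm carried out. -/
theorem star_mul_mul_self (x y : Octonion) : star x * (x * y) = normSq x • y := by
  ext <;> simp [normSq, re] <;> ring

theorem mul_star_mul_self (x y : Octonion) : x * (star x * y) = normSq x • y := by
  ext <;> simp [normSq, re] <;> ring

/-- Right alternativity, with the norm carried out. -/
theorem mul_mul_star_self (x y : Octonion) : (y * x) * star x = normSq x • y := by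
  ext <;> simp [normSq, re] <;> ring

@[simp] theorem re_zero : re 0 = 0 := rfl
@[simp] theorem re_one : re 1 = 1 := rfl
@[simp] theorem re_add (x y : Octonion) : re (x + y) = re x + re y := rfl
@[simp] theorem re_sub (x y : Octonion) : re (x - y) = re x - re y := rfl
@[simp] theorem re_smul (r : ℝ) (x : Octonion) : re (r • x) = r * re x := rfl
@[simp] theorem re_star (x : Octonion) : re (star x) = re x := by simp [re]

theorem re_mul_comm (x y : Octonion) : re (x * y) = re (y * x) := by
  simp [re]; ring

theorem re_mul_assoc (x y z : Octonion) : re (x * y * z) = re (x * (y * z)) := by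
  simp [re]; ring

theorem re_mul_star_comm (x y : Octonion) : re (x * star y) = re (y * star x) := by
  rw [← re_star, star_mul, star_star]

theorem re_star_mul (x y : Octonion) : re (star x * y) = re (x * star y) := by
  rw [re_mul_comm, re_mul_star_comm]

theorem normSq_add (x y : Octonion) :
    normSq (x + y) = normSq x + normSq y + 2 * re (x * star y) := by
  simp [normSq, re]; ring

theorem normSq_smul (r : ℝ) (x : Octonion) : normSq (r • x) = r ^ 2 * normSq x := by
  simp [normSq, re]; ring

/-- The linearization of `(x u) ū = |u|² x` at `u = y + z̄`. -/
theorem mul_mul_add_mul_star_mul_star (x y z : Octonion) :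
    x * y * z + x * star z * star y = (2 * re (y * z)) • x := by
  have h := mul_mul_star_self (y + star z) x
  simp only [mul_add, add_mul, star_add, star_star, normSq_add, mul_mul_star_self] at h
  have h2 := mul_mul_star_self (star z) x
  rw [star_star] at h2
  rw [h2, add_smul, add_smul, add_assoc, add_assoc, add_right_inj, ← add_assoc,
    add_comm _ (normSq (star z) • x), add_right_inj] at h
  rw [← h, add_comm]

/-- A form of the middle Moufang identity `(x y) (z x) = x (y z) x`, with the right-hand side
expressed through conjugation. -/
theorem mul_mul_mul_self (x y z : Octonion) :
    x * y * (z * x) = (2 * re (x * y * z)) • x - normSq x • star (y * z) := by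
  rw [eq_sub_iff_add_eq]
  have h := mul_mul_add_mul_star_mul_star x y (z * x)
  rw [star_mul, mul_star_mul_self, smul_mul_assoc, ← star_mul] at h
  rw [h, ← re_mul_assoc y z x, re_mul_comm, re_mul_assoc]

theorem eq_re_smul_one {x : Octonion} (h : star x = x) : x = re x • (1 : Octonion) := by
  have h1 := congrArg fst h
  have h2 := congrArg snd h
  simp only [Octonion.ext_iff, Quaternion.ext_iff, fst_star, snd_star] at h1 h2 ⊢
  simp [re] at *
  refine ⟨⟨?_, ?_, ?_⟩, ?_, ?_, ?_, ?_⟩ <;> linarith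

/-- A square root of `-1` is purely imaginary. -/
theorem star_eq_neg_of_mul_self {s : Octonion} (hs : s * s = -1) : star s = -s := by
  have hn : normSq s = 1 := by
    have h := congrArg normSq hs
    rw [normSq_mul] at h
    have h1 : normSq (-1) = 1 := by simp [normSq]
    nlinarith [normSq_nonneg s]
  have h := star_mul_mul_self s s
  rw [hs, hn, one_smul, mul_neg, mul_one] at h
  exact neg_eq_iff_eq_neg.1 h

section ofComplex

variable {s : Octonion}

theorem mul_self_mul (hs : s * s = -1) (x : Octonion) : s * (s * x) = -x := by
  have h := star_mul_mul_self s x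
  have hn : normSq s = 1 := by
    rw [normSq, star_eq_neg_of_mul_self hs, mul_neg, hs, neg_neg, re_one]
  rwa [star_eq_neg_of_mul_self hs, neg_mul, hn, one_smul, neg_eq_iff_eq_neg] at h

/-- Left multiplication by the complex subalgebra `ℝ ⊕ ℝ s` makes the octonions a `ℂ`-module;
`mul_ofComplex_mul` and `ofComplex_mul_assoc` give the commuting right action. -/
theorem ofComplex_mul_mul (hs : s * s = -1) (z w : ℂ) (x : Octonion) :
    ofComplex s (z * w) * x = ofComplex s z * (ofComplex s w * x) := by
  simp only [ofComplex, add_mul, mul_add, smul_mul_assoc, mul_smul_comm, one_mul,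
    mul_self_mul hs, Complex.mul_re, Complex.mul_im]
  module

theorem star_ofComplex (hs : s * s = -1) (z : ℂ) : star (ofComplex s z) = ofComplex s (star z) := by
  simp [ofComplex, star_eq_neg_of_mul_self hs]

theorem mul_ofComplex_mul (hs : s * s = -1) (z w : ℂ) (x : Octonion) :
    x * ofComplex s (z * w) = x * ofComplex s z * ofComplex s w := by
  have h := congrArg star (ofComplex_mul_mul hs (star w) (star z) (star x))
  simpa [star_mul, star_ofComplex hs] using h

theorem ofComplex_mul (hs : s * s = -1) (z w : ℂ) :
    ofComplex s (z * w) = ofComplex s z * ofComplex s w := by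
  simpa using ofComplex_mul_mul hs z w 1

theorem ofComplex_mul_assoc (z w : ℂ) (x : Octonion) :
    ofComplex s z * x * ofComplex s w = ofComplex s z * (x * ofComplex s w) := by
  have h : s * x * s = s * (x * s) := by
    ext <;> simp <;> ring
  simp only [ofComplex, add_mul, mul_add, smul_mul_assoc, mul_smul_comm, one_mul, mul_one, h]

end ofComplex

end Octonion

namespace H3

open Octonion

/-! ### Coordinates on Jordan matrices -/

/-- The Jordan matrix with real diagonal `a, b, c` and entries `X₁₂ = x`, `X₂₃ = y`, `X₃₁ = z`;
with this cyclic choice the cubic term of the determinant is `2 Re (x y z)`. -/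
def mk (a b c : ℝ) (x y z : Octonion) : H3 :=
  ⟨!![a • 1, x, star z; star x, b • 1, y; z, star y, c • 1], by
    change _ᴴ = _
    ext1 i j
    fin_cases i <;> fin_cases j <;> simp [Matrix.conjTranspose_apply]⟩

theorem star_apply (X : H3) (i j : Fin 3) : star (X.1 i j) = X.1 j i := by
  have h : X.1ᴴ = X.1 := X.2
  exact congrFun (congrFun h j) i

theorem eq_mk (X : H3) : X = mk (X.1 0 0).re (X.1 1 1).re (X.1 2 2).re
    (X.1 0 1) (X.1 1 2) (X.1 2 0) := by
  apply Subtype.ext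
  ext1 i j
  have h (i : Fin 3) := eq_re_smul_one (star_apply X i i)
  fin_cases i <;> fin_cases j <;> simp [mk, star_apply, ← h]

theorem exists_mk (X : H3) : ∃ a b c x y z, X = mk a b c x y z := ⟨_, _, _, _, _, _, eq_mk X⟩

variable (a b c a' b' c' : ℝ) (x y z x' y' z' : Octonion)

theorem mk_add : mk a b c x y z + mk a' b' c' x' y' z' =
    mk (a + a') (b + b') (c + c') (x + x') (y + y') (z + z') := by
  apply Subtype.ext
  ext1 i j
  fin_cases i <;> fin_cases j <;> simp [mk, add_smul]

theorem smul_mk (r : ℝ) : r • mk a b c x y z =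
    mk (r * a) (r * b) (r * c) (r • x) (r • y) (r • z) := by
  apply Subtype.ext
  ext1 i j
  fin_cases i <;> fin_cases j <;> simp [mk, mul_smul]

theorem mk_sub : mk a b c x y z - mk a' b' c' x' y' z' =
    mk (a - a') (b - b') (c - c') (x - x') (y - y') (z - z') := by
  apply Subtype.ext
  ext1 i j
  fin_cases i <;> fin_cases j <;> simp [mk, sub_smul]

theorem zero_eq_mk : (0 : H3) = mk 0 0 0 0 0 0 := by
  apply Subtype.ext
  ext1 i j
  fin_cases i <;> fin_cases j <;> simp [mk]

theorem one_eq_mk : one = mk 1 1 1 0 0 0 := by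
  apply Subtype.ext
  ext1 i j
  fin_cases i <;> fin_cases j <;> simp [mk, one]

theorem hermTrace_mk : hermTrace (mk a b c x y z) = a + b + c := by
  simp [hermTrace, mk, Fin.sum_univ_three]

variable {a b c a' b' c' x y z x' y' z'} in
theorem mk_inj : mk a b c x y z = mk a' b' c' x' y' z' ↔
    a = a' ∧ b = b' ∧ c = c' ∧ x = x' ∧ y = y' ∧ z = z' := by
  constructor
  · intro h
    have h1 (i j : Fin 3) := congrFun (congrFun (congrArg Subtype.val h) i) j
    have h00 := congrArg re (h1 0 0)
    have h11 := congrArg re (h1 1 1)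
    have h22 := congrArg re (h1 2 2)
    simp [mk] at h00 h11 h22
    exact ⟨h00, h11, h22, h1 0 1, h1 1 2, h1 2 0⟩
  · rintro ⟨rfl, rfl, rfl, rfl, rfl, rfl⟩
    rfl

theorem jordan_mk : jordan (mk a b c x y z) (mk a' b' c' x' y' z') =
    mk (a * a' + re (x * star x') + re (z * star z'))
      (b * b' + re (x * star x') + re (y * star y'))
      (c * c' + re (y * star y') + re (z * star z'))
      ((1 / 2 : ℝ) • ((a + b) • x' + (a' + b') • x + star (y * z') + star (y' * z)))
      ((1 / 2 : ℝ) • ((b + c) • y' + (b' + c') • y + star (z * x') + star (z' * x)))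
      ((1 / 2 : ℝ) • ((c + a) • z' + (c' + a') • z + star (x * y') + star (x' * y))) := by
  rw [eq_mk (jordan _ _), mk_inj]
  refine ⟨?_, ?_, ?_, ?_, ?_, ?_⟩ <;>
    simp [mk, jordan]
  · rw [re_mul_star_comm x' x, re_star_mul, re_star_mul, re_mul_star_comm z' z]
    ring
  · rw [re_mul_star_comm y' y, re_star_mul, re_star_mul, re_mul_star_comm x' x]
    ring
  · rw [re_mul_star_comm z' z, re_star_mul, re_star_mul, re_mul_star_comm y' y]
    ring
  all_goals module

theorem hermTrace_add (X Y : H3) : hermTrace (X + Y) = hermTrace X + hermTrace Y := by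
  simp [hermTrace, Finset.sum_add_distrib]

theorem hermTrace_smul (r : ℝ) (X : H3) : hermTrace (r • X) = r * hermTrace X := by
  simp [hermTrace, Finset.mul_sum]

theorem hermTrace_sub (X Y : H3) : hermTrace (X - Y) = hermTrace X - hermTrace Y := by
  simp [hermTrace]

@[simp] theorem hermTrace_zero : hermTrace (0 : H3) = 0 := by
  simp [hermTrace]

@[simp] theorem hermTrace_one : hermTrace one = 3 := by
  rw [one_eq_mk, hermTrace_mk]
  norm_num

theorem hermTrace_jordan_mk :
    hermTrace (jordan (mk a b c x y z) (mk a' b' c' x' y' z')) =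
      a * a' + b * b' + c * c' +
        2 * (re (x * star x') + re (y * star y') + re (z * star z')) := by
  rw [jordan_mk, hermTrace_mk]
  ring

theorem freudenthal_mk : freudenthal (mk a b c x y z) (mk a' b' c' x' y' z') =
    mk ((b * c' + b' * c) / 2 - re (y * star y')) ((c * a' + c' * a) / 2 - re (z * star z'))
      ((a * b' + a' * b) / 2 - re (x * star x'))
      ((1 / 2 : ℝ) • (star (y * z') + star (y' * z) - c • x' - c' • x))
      ((1 / 2 : ℝ) • (star (z * x') + star (z' * x) - a • y' - a' • y))
      ((1 / 2 : ℝ) • (star (x * y') + star (x' * y) - b • z' - b' • z)) := by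
  rw [freudenthal, hermTrace_jordan_mk, jordan_mk, hermTrace_mk, hermTrace_mk, one_eq_mk]
  simp only [smul_mk, mk_add, mk_sub, mk_inj]
  refine ⟨by ring, by ring, by ring, ?_, ?_, ?_⟩ <;> module

theorem freudenthal_self_mk : freudenthal (mk a b c x y z) (mk a b c x y z) =
    mk (b * c - normSq y) (c * a - normSq z) (a * b - normSq x)
      (star (y * z) - c • x) (star (z * x) - a • y) (star (x * y) - b • z) := by
  rw [freudenthal_mk, mk_inj]
  simp only [normSq]
  refine ⟨by ring, by ring, by ring, ?_, ?_, ?_⟩ <;> module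

theorem det_mk : det (mk a b c x y z) = a * b * c - a * normSq y - b * normSq z - c * normSq x +
    2 * re (x * y * z) := by
  have h1 : re (star (y * z) * star x) = re (x * y * z) := by
    rw [← star_mul, re_star, re_mul_assoc]
  have h2 : re (star (z * x) * star y) = re (x * y * z) := by
    rw [← star_mul, re_star, ← re_mul_assoc, re_mul_comm, re_mul_assoc]
  have h3 : re (star (x * y) * star z) = re (x * y * z) := by
    rw [← star_mul, re_star, re_mul_comm]
  rw [det, triple, freudenthal_self_mk, hermTrace_jordan_mk]
  simp only [sub_mul, re_sub, h1, h2, h3, smul_mul_assoc, re_smul]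
  simp only [normSq]
  ring

/-! ### Identities of the Jordan and Freudenthal products -/

theorem jordan_comm (X Y : H3) : jordan X Y = jordan Y X := by
  apply Subtype.ext
  simp [jordan, add_comm]

theorem jordan_add (X Y Z : H3) : jordan X (Y + Z) = jordan X Y + jordan X Z := by
  apply Subtype.ext
  simp only [jordan, Submodule.coe_add, mul_add, add_mul]
  module

theorem jordan_smul (r : ℝ) (X Y : H3) : jordan X (r • Y) = r • jordan X Y := by
  apply Subtype.ext
  simp only [jordan, Submodule.coe_smul, mul_smul_comm, smul_mul_assoc]
  module

theorem jordan_sub (X Y Z : H3) : jordan X (Y - Z) = jordan X Y - jordan X Z := by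
  rw [sub_eq_add_neg, ← neg_one_smul ℝ Z, jordan_add, jordan_smul]
  module

theorem add_jordan (X Y Z : H3) : jordan (X + Y) Z = jordan X Z + jordan Y Z := by
  simp only [jordan_comm _ Z, jordan_add]

theorem sub_jordan (X Y Z : H3) : jordan (X - Y) Z = jordan X Z - jordan Y Z := by
  simp only [jordan_comm _ Z, jordan_sub]

theorem smul_jordan (r : ℝ) (X Y : H3) : jordan (r • X) Y = r • jordan X Y := by
  simp only [jordan_comm _ Y, jordan_smul]

@[simp] theorem jordan_one (X : H3) : jordan X one = X := by
  apply Subtype.ext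
  simp only [jordan, one, mul_one, one_mul]
  module

@[simp] theorem one_jordan (X : H3) : jordan one X = X := by
  rw [jordan_comm, jordan_one]

@[simp] theorem jordan_zero (X : H3) : jordan X 0 = 0 := by
  simpa using jordan_smul 0 X 0

@[simp] theorem zero_jordan (X : H3) : jordan 0 X = 0 := by
  rw [jordan_comm, jordan_zero]

theorem freudenthal_comm (X Y : H3) : freudenthal X Y = freudenthal Y X := by
  simp only [freudenthal, jordan_comm X Y, mul_comm (hermTrace X), add_comm (hermTrace Y • X)]

theorem freudenthal_add (X Y Z : H3) :
    freudenthal X (Y + Z) = freudenthal X Y + freudenthal X Z := by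
  simp only [freudenthal, jordan_add, hermTrace_add]
  module

theorem freudenthal_smul (r : ℝ) (X Y : H3) :
    freudenthal X (r • Y) = r • freudenthal X Y := by
  simp only [freudenthal, jordan_smul, hermTrace_smul]
  module

theorem add_freudenthal (X Y Z : H3) :
    freudenthal (X + Y) Z = freudenthal X Z + freudenthal Y Z := by
  simp only [freudenthal_comm _ Z, freudenthal_add]

theorem smul_freudenthal (r : ℝ) (X Y : H3) :
    freudenthal (r • X) Y = r • freudenthal X Y := by
  simp only [freudenthal_comm _ Y, freudenthal_smul]

/-- The trace form `tr (X ∘ Y)` is positive definite. -/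
theorem hermTrace_jordan_self_nonneg (X : H3) : 0 ≤ hermTrace (jordan X X) := by
  obtain ⟨a, b, c, x, y, z, rfl⟩ := exists_mk X
  rw [hermTrace_jordan_mk]
  have hx := normSq_nonneg x
  have hy := normSq_nonneg y
  have hz := normSq_nonneg z
  rw [normSq] at hx hy hz
  nlinarith [mul_self_nonneg a, mul_self_nonneg b, mul_self_nonneg c]

theorem eq_zero_of_hermTrace_jordan_self {X : H3} (h : hermTrace (jordan X X) = 0) : X = 0 := by
  obtain ⟨a, b, c, x, y, z, rfl⟩ := exists_mk X
  rw [hermTrace_jordan_mk] at h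
  have hx := normSq_nonneg x
  have hy := normSq_nonneg y
  have hz := normSq_nonneg z
  have ha := mul_self_nonneg a
  have hb := mul_self_nonneg b
  have hc := mul_self_nonneg c
  simp only [← normSq_def] at h
  rw [zero_eq_mk, mk_inj]
  refine ⟨mul_self_eq_zero.1 ?_, mul_self_eq_zero.1 ?_, mul_self_eq_zero.1 ?_,
    normSq_eq_zero.1 ?_, normSq_eq_zero.1 ?_, normSq_eq_zero.1 ?_⟩ <;> linarith

/-- The characteristic equation: `(X * X) ∘ X = det X`. -/
theorem jordan_freudenthal_self (X : H3) : jordan (freudenthal X X) X = det X • one := by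
  obtain ⟨a, b, c, x, y, z, rfl⟩ := exists_mk X
  have e1 (x y z : Octonion) : re (star (y * z) * star x) = re (x * y * z) := by
    rw [← star_mul, re_star, re_mul_assoc]
  have e2 : re (y * z * x) = re (x * y * z) := by
    rw [re_mul_comm, re_mul_assoc]
  have e3 : re (z * x * y) = re (x * y * z) := by
    rw [re_mul_assoc, re_mul_comm]
  have e4 (x y : Octonion) : x * (star x * star y) = normSq x • star y :=
    mul_star_mul_self _ _
  rw [freudenthal_self_mk, jordan_mk, det_mk, one_eq_mk, smul_mk, mk_inj]
  refine ⟨?_, ?_, ?_, ?_, ?_, ?_⟩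
  iterate 3
    simp only [sub_mul, re_sub, e1, e2, e3, smul_mul_assoc, re_smul, ← normSq_def]
    ring
  all_goals
    simp only [star_sub, star_smul, star_mul, star_star, star_trivial, sub_mul, mul_sub,
      smul_mul_assoc, mul_smul_comm, mul_mul_star_self, star_mul_mul_self, smul_zero]
    module

/-- The adjoint identity: `(X * X) * (X * X) = (det X) X`. -/
theorem freudenthal_freudenthal_self (X : H3) :
    freudenthal (freudenthal X X) (freudenthal X X) = det X • X := by
  obtain ⟨a, b, c, x, y, z, rfl⟩ := exists_mk X
  have e2 : re (y * z * x) = re (x * y * z) := by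
    rw [re_mul_comm, re_mul_assoc]
  have e3 : re (z * x * y) = re (x * y * z) := by
    rw [re_mul_assoc, re_mul_comm]
  have hn (p q w : Octonion) (r : ℝ) : normSq (star (p * q) - r • w) =
      normSq p * normSq q + r ^ 2 * normSq w - 2 * r * re (p * q * w) := by
    rw [sub_eq_add_neg, ← neg_smul, normSq_add, normSq_star, normSq_mul, normSq_smul, star_smul,
      mul_smul_comm, re_smul, ← star_mul, re_star, star_trivial, re_mul_comm w]
    ring
  have ho (p q w : Octonion) (r t : ℝ) :
      star ((star (p * q) - r • w) * (star (q * w) - t • p)) =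
        (2 * re (q * w * p) - r * normSq w - t * normSq p) • q +
          (r * t - normSq q) • star (w * p) := by
    rw [star_mul, star_sub, star_sub, star_star, star_star]
    simp only [star_smul, star_trivial, sub_mul, mul_sub, smul_mul_assoc, mul_smul_comm,
      mul_mul_mul_self, mul_mul_star_self, star_mul_mul_self, star_mul]
    module
  rw [freudenthal_self_mk, freudenthal_self_mk, det_mk, smul_mk, mk_inj]
  simp only [hn, ho, e2, e3]
  refine ⟨by ring, by ring, by ring, ?_, ?_, ?_⟩ <;> module

/-- The trilinear form `tr ((X * Y) ∘ Z)`, the polarization of the determinant, is symmetric. -/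
theorem hermTrace_triple_right_comm (X Y Z : H3) :
    hermTrace (triple X Y Z) = hermTrace (triple X Z Y) := by
  obtain ⟨a, b, c, x, y, z, rfl⟩ := exists_mk X
  obtain ⟨a', b', c', x', y', z', rfl⟩ := exists_mk Y
  obtain ⟨a'', b'', c'', x'', y'', z'', rfl⟩ := exists_mk Z
  have e1 (x y z : Octonion) : re (star (y * z) * star x) = re (x * y * z) := by
    rw [← star_mul, re_star, re_mul_assoc]
  have e2 (x y z : Octonion) : re (y * z * x) = re (x * y * z) := by
    rw [re_mul_comm, re_mul_assoc]
  rw [triple, triple, freudenthal_mk, freudenthal_mk, hermTrace_jordan_mk, hermTrace_jordan_mk]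
  simp only [smul_mul_assoc, add_mul, sub_mul, re_add, re_sub, re_smul, e1]
  rw [re_mul_star_comm x'' x', re_mul_star_comm y'' y', re_mul_star_comm z'' z']
  linear_combination (e2 z' x'' y - e2 x'' y' z + e2 x' y'' z - e2 y'' z' x +
    e2 y' z'' x - e2 z'' x' y)

/-! ### Congruence by complex matrices -/

theorem matrix_mul_assoc_of_entries {A B C : Matrix (Fin 3) (Fin 3) Octonion}
    (h : ∀ i k l j, A i k * B k l * C l j = A i k * (B k l * C l j)) :
    A * B * C = A * (B * C) := by
  ext1 i j
  simp only [Matrix.mul_apply, Finset.sum_mul, Finset.mul_sum, h]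
  exact Finset.sum_comm

section

variable {s : Octonion}

theorem conjTranspose_map_ofComplex (hs : s * s = -1) (N : Matrix (Fin 3) (Fin 3) ℂ) :
    (N.map (ofComplex s))ᴴ = Nᴴ.map (ofComplex s) := by
  ext1 i j
  simp [Matrix.conjTranspose_apply, star_ofComplex hs]

theorem map_ofComplex_mul (hs : s * s = -1) (N N' : Matrix (Fin 3) (Fin 3) ℂ) :
    (N * N').map (ofComplex s) = N.map (ofComplex s) * N'.map (ofComplex s) := by
  have hadd (z w : ℂ) : ofComplex s (z + w) = ofComplex s z + ofComplex s w := by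
    simp only [ofComplex, Complex.add_re, Complex.add_im]
    module
  ext1 i j
  simp only [Matrix.map_apply, Matrix.mul_apply, Fin.sum_univ_three, hadd, ofComplex_mul hs]

theorem map_ofComplex_mul_assoc (hs : s * s = -1) (N N' : Matrix (Fin 3) (Fin 3) ℂ)
    (X : Matrix (Fin 3) (Fin 3) Octonion) :
    N.map (ofComplex s) * X * (N'.map (ofComplex s))ᴴ =
      N.map (ofComplex s) * (X * (N'.map (ofComplex s))ᴴ) := by
  rw [conjTranspose_map_ofComplex hs]
  exact matrix_mul_assoc_of_entries fun i k l j => ofComplex_mul_assoc _ _ _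

/-- The congruence `X ↦ N X N†` of Jordan matrices by a matrix `N` over the complex subalgebra
`ℝ ⊕ ℝ s`. -/
def sandwich (hs : s * s = -1) (N : Matrix (Fin 3) (Fin 3) ℂ) : H3 →ₗ[ℝ] H3 where
  toFun X := ⟨N.map (ofComplex s) * X.1 * (N.map (ofComplex s))ᴴ, by
    have hX : X.1ᴴ = X.1 := X.2
    change _ᴴ = _
    rw [Matrix.conjTranspose_mul, Matrix.conjTranspose_mul, hX,
      Matrix.conjTranspose_conjTranspose, map_ofComplex_mul_assoc hs]⟩
  map_add' X Y := by
    apply Subtype.ext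
    simp [mul_add, add_mul]
  map_smul' r X := by
    apply Subtype.ext
    simp [mul_smul_comm, smul_mul_assoc]

theorem sandwich_coe (hs : s * s = -1) (N : Matrix (Fin 3) (Fin 3) ℂ) (X : H3) :
    (sandwich hs N X).1 = N.map (ofComplex s) * X.1 * (N.map (ofComplex s))ᴴ := rfl

theorem sandwich_one (hs : s * s = -1) (X : H3) : sandwich hs 1 X = X := by
  have h : (1 : Matrix (Fin 3) (Fin 3) ℂ).map (ofComplex s) = 1 :=
    Matrix.map_one _ (by simp [ofComplex]) (by simp [ofComplex])
  apply Subtype.ext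
  rw [sandwich_coe, h, Matrix.conjTranspose_one, one_mul, mul_one]

theorem sandwich_mul (hs : s * s = -1) (N N' : Matrix (Fin 3) (Fin 3) ℂ) (X : H3) :
    sandwich hs (N * N') X = sandwich hs N (sandwich hs N' X) := by
  apply Subtype.ext
  have hl (Y : Matrix (Fin 3) (Fin 3) Octonion) :
      N.map (ofComplex s) * N'.map (ofComplex s) * Y =
        N.map (ofComplex s) * (N'.map (ofComplex s) * Y) :=
    matrix_mul_assoc_of_entries fun i k l j => by
      rw [Matrix.map_apply, Matrix.map_apply, ← ofComplex_mul hs, ofComplex_mul_mul hs]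
  have hr (Y : Matrix (Fin 3) (Fin 3) Octonion) :
      Y * N'ᴴ.map (ofComplex s) * Nᴴ.map (ofComplex s) =
        Y * (N'ᴴ.map (ofComplex s) * Nᴴ.map (ofComplex s)) :=
    matrix_mul_assoc_of_entries fun i k l j => by
      rw [Matrix.map_apply, Matrix.map_apply, ← ofComplex_mul hs, mul_ofComplex_mul hs]
  simp only [sandwich_coe, map_ofComplex_mul hs, Matrix.conjTranspose_mul]
  rw [hl, conjTranspose_map_ofComplex hs, conjTranspose_map_ofComplex hs, ← hr,
    ← conjTranspose_map_ofComplex hs N', map_ofComplex_mul_assoc hs, map_ofComplex_mul_assoc hs]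

/-- Cyclic permutation of rows and columns preserves the determinant. -/
theorem det_mk_rotate (a b c : ℝ) (x y z : Octonion) :
    det (mk b c a y z x) = det (mk a b c x y z) := by
  have h : re (y * z * x) = re (x * y * z) := by rw [re_mul_comm, re_mul_assoc]
  rw [det_mk, det_mk, h]
  ring

/-- Exchanging the first two rows and the first two columns preserves the determinant. -/
theorem det_mk_reflect (a b c : ℝ) (x y z : Octonion) :
    det (mk b a c (star x) (star z) (star y)) = det (mk a b c x y z) := by
  have h : re (star x * star z * star y) = re (x * y * z) := by
    rw [re_mul_assoc, ← star_mul, ← star_mul, re_star, re_mul_assoc, re_mul_comm, re_mul_assoc]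
    rw [re_mul_comm]
  rw [det_mk, det_mk, h, normSq_star, normSq_star, normSq_star]
  ring

/-- Adding `m` times the second row to the first, for an arbitrary octonion `m`, together with
the conjugate column operation, does not change the determinant. -/
theorem det_mk_shear (a b c : ℝ) (x y z m : Octonion) :
    det (mk (a + 2 * re (m * star x) + b * normSq m) b c (x + b • m) y (z + star y * star m)) =
      det (mk a b c x y z) := by
  have h1 : re (m * y * z) = re (z * (m * y)) := re_mul_comm _ _
  have h2 : re (x * y * (star y * star m)) = normSq y * re (m * star x) := by
    rw [← re_mul_assoc, mul_mul_star_self, smul_mul_assoc, re_smul, re_mul_star_comm]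
  have h3 : re (m * y * (star y * star m)) = normSq y * normSq m := by
    rw [← re_mul_assoc, mul_mul_star_self, smul_mul_assoc, re_smul, normSq_def m]
  rw [det_mk, det_mk, normSq_add, normSq_add, normSq_smul, ← star_mul, normSq_star, normSq_mul,
    star_star, star_smul, mul_smul_comm, re_smul, re_mul_star_comm x m]
  simp only [add_mul, mul_add, smul_mul_assoc, re_add, re_smul, star_mul, h1, h2, h3, star_trivial]
  ring

theorem sandwich_transvection (hs : s * s = -1) (w : ℂ) (a b c : ℝ) (x y z : Octonion) :
    sandwich hs (Matrix.transvection 0 1 w) (mk a b c x y z) =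
      mk (a + 2 * re (ofComplex s w * star x) + b * normSq (ofComplex s w)) b c
        (x + b • ofComplex s w) y (z + star y * star (ofComplex s w)) := by
  have h : (Matrix.transvection 0 1 w : Matrix (Fin 3) (Fin 3) ℂ).map (ofComplex s) =
      !![1, ofComplex s w, 0; 0, 1, 0; 0, 0, 1] := by
    ext1 i j
    fin_cases i <;> fin_cases j <;>
      simp [Matrix.transvection, Matrix.single, ofComplex]
  rw [eq_mk (sandwich hs _ _), mk_inj, sandwich_coe, h]
  generalize ofComplex s w = m
  refine ⟨?_, ?_, ?_, ?_, ?_, ?_⟩ <;>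
    simp [mk, Matrix.mul_apply, Fin.sum_univ_three, Matrix.conjTranspose_apply]
  rw [add_mul, re_add, smul_mul_assoc, re_smul, re_mul_star_comm x m, normSq_def]
  ring

theorem sandwich_rotation (hs : s * s = -1) (a b c : ℝ) (x y z : Octonion) :
    sandwich hs !![0, 1, 0; 0, 0, 1; 1, 0, 0] (mk a b c x y z) = mk b c a y z x := by
  have h : (!![0, 1, 0; 0, 0, 1; 1, 0, 0] : Matrix (Fin 3) (Fin 3) ℂ).map (ofComplex s) =
      !![0, 1, 0; 0, 0, 1; 1, 0, 0] := by
    ext1 i j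
    fin_cases i <;> fin_cases j <;> simp [ofComplex]
  rw [eq_mk (sandwich hs _ _), mk_inj, sandwich_coe, h]
  refine ⟨?_, ?_, ?_, ?_, ?_, ?_⟩ <;>
    simp [mk, Matrix.mul_apply, Fin.sum_univ_three, Matrix.conjTranspose_apply]

theorem sandwich_reflection (hs : s * s = -1) (a b c : ℝ) (x y z : Octonion) :
    sandwich hs !![0, 1, 0; 1, 0, 0; 0, 0, 1] (mk a b c x y z) =
      mk b a c (star x) (star z) (star y) := by
  have h : (!![0, 1, 0; 1, 0, 0; 0, 0, 1] : Matrix (Fin 3) (Fin 3) ℂ).map (ofComplex s) =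
      !![0, 1, 0; 1, 0, 0; 0, 0, 1] := by
    ext1 i j
    fin_cases i <;> fin_cases j <;> simp [ofComplex]
  rw [eq_mk (sandwich hs _ _), mk_inj, sandwich_coe, h]
  refine ⟨?_, ?_, ?_, ?_, ?_, ?_⟩ <;>
    simp [mk, Matrix.mul_apply, Fin.sum_univ_three, Matrix.conjTranspose_apply]

theorem sandwich_sign (hs : s * s = -1) (a b c : ℝ) (x y z : Octonion) :
    sandwich hs (Matrix.diagonal ![1, 1, -1]) (mk a b c x y z) = mk a b c x (-y) (-z) := by
  have h : (Matrix.diagonal ![1, 1, -1] : Matrix (Fin 3) (Fin 3) ℂ).map (ofComplex s) =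
      !![1, 0, 0; 0, 1, 0; 0, 0, -1] := by
    ext1 i j
    fin_cases i <;> fin_cases j <;> simp [ofComplex]
  rw [eq_mk (sandwich hs _ _), mk_inj, sandwich_coe, h]
  refine ⟨?_, ?_, ?_, ?_, ?_, ?_⟩ <;>
    simp [mk, Matrix.mul_apply, Fin.sum_univ_three, Matrix.conjTranspose_apply]

/-- The complex matrices whose congruences preserve the determinant. -/
def detPreserving (hs : s * s = -1) : Submonoid (Matrix (Fin 3) (Fin 3) ℂ) where
  carrier := {N | ∀ X, det (sandwich hs N X) = det X}
  one_mem' X := by rw [sandwich_one]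
  mul_mem' {N N'} h h' X := by rw [sandwich_mul, h, h']

theorem mem_detPreserving (hs : s * s = -1) {N : Matrix (Fin 3) (Fin 3) ℂ} :
    N ∈ detPreserving hs ↔ ∀ a b c x y z, det (sandwich hs N (mk a b c x y z)) =
      det (mk a b c x y z) :=
  ⟨fun h _ _ _ _ _ _ => h _, fun h X => by rw [eq_mk X, h]⟩

theorem rotation_mem (hs : s * s = -1) : !![0, 1, 0; 0, 0, 1; 1, 0, 0] ∈ detPreserving hs :=
  (mem_detPreserving hs).2 fun _ _ _ _ _ _ => by rw [sandwich_rotation, det_mk_rotate]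

theorem reflection_mem (hs : s * s = -1) : !![0, 1, 0; 1, 0, 0; 0, 0, 1] ∈ detPreserving hs :=
  (mem_detPreserving hs).2 fun _ _ _ _ _ _ => by rw [sandwich_reflection, det_mk_reflect]

theorem submatrix_rotation_mem (hs : s * s = -1) {N : Matrix (Fin 3) (Fin 3) ℂ}
    (hN : N ∈ detPreserving hs) : N.submatrix (finRotate 3) (finRotate 3) ∈ detPreserving hs := by
  have hR := rotation_mem hs
  have he : ⇑(finRotate 3) = ![1, 2, 0] := by decide
  convert mul_mem (mul_mem hR hN) (mul_mem hR hR) using 1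
  rw [Matrix.eta_fin_three N, he]
  ext1 k l
  fin_cases k <;> fin_cases l <;> simp

theorem submatrix_reflection_mem (hs : s * s = -1) {N : Matrix (Fin 3) (Fin 3) ℂ}
    (hN : N ∈ detPreserving hs) :
    N.submatrix (Equiv.swap 0 1) (Equiv.swap 0 1) ∈ detPreserving hs := by
  have hW := reflection_mem hs
  have he : ⇑(Equiv.swap (0 : Fin 3) 1) = ![1, 0, 2] := by decide
  convert mul_mem (mul_mem hW hN) hW using 1
  rw [Matrix.eta_fin_three N, he]
  ext1 k l
  fin_cases k <;> fin_cases l <;> simp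

theorem submatrix_transvection (e : Equiv.Perm (Fin 3)) {i j i' j' : Fin 3} (hi : e i = i')
    (hj : e j = j') (w : ℂ) :
    (Matrix.transvection i' j' w).submatrix e e = Matrix.transvection i j w := by
  subst hi hj
  ext1 k l
  simp [Matrix.transvection, Matrix.single, Matrix.one_apply]

theorem sign_mem (hs : s * s = -1) : Matrix.diagonal ![1, 1, -1] ∈ detPreserving hs :=
  (mem_detPreserving hs).2 fun _ _ _ _ _ _ => by
    rw [sandwich_sign, det_mk, det_mk]
    simp [normSq]

/-- All elementary transvections preserve the determinant, being conjugates of a single one under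
permutation matrices. -/
theorem transvection_mem (hs : s * s = -1) {i j : Fin 3} (hij : i ≠ j) (w : ℂ) :
    Matrix.transvection i j w ∈ detPreserving hs := by
  have h01 : Matrix.transvection 0 1 w ∈ detPreserving hs :=
    (mem_detPreserving hs).2 fun _ _ _ _ _ _ => by rw [sandwich_transvection, det_mk_shear]
  have hr {i j i' j' : Fin 3} (hi : finRotate 3 i = i') (hj : finRotate 3 j = j')
      (h : Matrix.transvection i' j' w ∈ detPreserving hs) :
      Matrix.transvection i j w ∈ detPreserving hs :=
    submatrix_transvection _ hi hj w ▸ submatrix_rotation_mem hs h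
  have h10 : Matrix.transvection 1 0 w ∈ detPreserving hs :=
    submatrix_transvection (i := 1) (j := 0) (i' := 0) (j' := 1) (Equiv.swap 0 1) (by decide)
      (by decide) w ▸
      submatrix_reflection_mem hs h01
  have h20 : Matrix.transvection 2 0 w ∈ detPreserving hs := hr (by decide) (by decide) h01
  have h12 : Matrix.transvection 1 2 w ∈ detPreserving hs := hr (by decide) (by decide) h20
  have h02 : Matrix.transvection 0 2 w ∈ detPreserving hs := hr (by decide) (by decide) h10
  have h21 : Matrix.transvection 2 1 w ∈ detPreserving hs := hr (by decide) (by decide) h02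
  have hcases : i = 0 ∧ j = 1 ∨ i = 1 ∧ j = 0 ∨ i = 2 ∧ j = 0 ∨ i = 1 ∧ j = 2 ∨
      i = 0 ∧ j = 2 ∨ i = 2 ∧ j = 1 := by
    revert i j
    decide
  rcases hcases with ⟨rfl, rfl⟩ | ⟨rfl, rfl⟩ | ⟨rfl, rfl⟩ | ⟨rfl, rfl⟩ | ⟨rfl, rfl⟩ | ⟨rfl, rfl⟩
  exacts [h01, h10, h20, h12, h02, h21]

/-- A diagonal matrix of determinant `ε = ±1` is a product of `diag (d, d⁻¹, 1)`,
`diag (1, e, e⁻¹)` and `diag (1, 1, ε)`, the first two of which are products of transvections. -/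
theorem diagonal_mem (hs : s * s = -1) {D : Fin 3 → ℂ}
    (hD : (Matrix.diagonal D).det = 1 ∨ (Matrix.diagonal D).det = -1) :
    Matrix.diagonal D ∈ detPreserving hs := by
  have h1 {d : ℂ} (hd : d ≠ 0) : Matrix.diagonal ![d, d⁻¹, 1] ∈ detPreserving hs := by
    have h01 (w : ℂ) := transvection_mem hs (i := 0) (j := 1) (by decide) w
    have h10 (w : ℂ) := transvection_mem hs (i := 1) (j := 0) (by decide) w
    -- the Weyl elements `w(d) = E₁₂(d) E₂₁(-d⁻¹) E₁₂(d)` satisfy `w(d) w(-1) = diag (d, d⁻¹)`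
    have := mul_mem (mul_mem (mul_mem (h01 d) (h10 (-d⁻¹))) (h01 d))
      (mul_mem (mul_mem (h01 (-1)) (h10 1)) (h01 (-1)))
    convert this using 1
    ext1 k l
    fin_cases k <;> fin_cases l <;>
      simp [Matrix.transvection, Matrix.single, Matrix.mul_apply, Fin.sum_univ_three, hd]
  have h2 {d : ℂ} (hd : d ≠ 0) : Matrix.diagonal ![1, d, d⁻¹] ∈ detPreserving hs := by
    have h := submatrix_rotation_mem hs (submatrix_rotation_mem hs (h1 hd))
    rw [Matrix.submatrix_diagonal_equiv, Matrix.submatrix_diagonal_equiv] at h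
    convert h using 2
    ext i
    fin_cases i <;> rfl
  have h3 {ε : ℂ} (hε : ε = 1 ∨ ε = -1) : Matrix.diagonal ![1, 1, ε] ∈ detPreserving hs := by
    rcases hε with rfl | rfl
    · convert one_mem (detPreserving hs) using 1
      ext1 k l
      fin_cases k <;> fin_cases l <;> simp
    · exact sign_mem hs
  rw [Matrix.det_diagonal, Fin.prod_univ_three] at hD
  have hne : D 0 * D 1 * D 2 ≠ 0 := by rcases hD with h | h <;> simp [h]
  have h0 : D 0 ≠ 0 := left_ne_zero_of_mul (left_ne_zero_of_mul hne)
  have h01 : D 0 * D 1 ≠ 0 := left_ne_zero_of_mul hne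
  have := mul_mem (mul_mem (h1 h0) (h2 h01)) (h3 hD)
  convert this using 1
  rw [Matrix.diagonal_mul_diagonal, Matrix.diagonal_mul_diagonal]
  congr 1
  ext i
  fin_cases i
  · simp
  · simp [h0]
  · have hD1 : D 1 ≠ 0 := right_ne_zero_of_mul h01
    simp
    field_simp

/-- Gaussian elimination writes a matrix of determinant `±1` as a product of transvections and a
diagonal matrix of the same determinant. -/
theorem det_sandwich (hs : s * s = -1) {N : Matrix (Fin 3) (Fin 3) ℂ}
    (hN : N.det = 1 ∨ N.det = -1) (X : H3) : det (sandwich hs N X) = det X := by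
  suffices N ∈ detPreserving hs from this X
  refine Matrix.diagonal_transvection_induction (· ∈ detPreserving hs) N ?_ ?_ ?_
  · intro D hD
    exact diagonal_mem hs (by rwa [hD])
  · intro t
    exact transvection_mem hs t.hij t.c
  · intro A B hA hB
    exact mul_mem hA hB

end

theorem det_of_generator {T : H3 ≃ₗ[ℝ] H3} {M : Matrix (Fin 3) (Fin 3) Octonion}
    (hM : IsGenerator M) (hT : ∀ X : H3, (T X).1 = M * X.1 * Mᴴ) (X : H3) :
    det (T X) = det X := by
  obtain ⟨s, N, hs, hN, rfl⟩ := hM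
  rw [← det_sandwich hs hN X]
  exact congrArg det (Subtype.ext (hT X))

theorem TSL3_le_E6 : TSL3 ≤ E6 := by
  rw [TSL3, Subgroup.closure_le]
  rintro T ⟨M, hM, hT⟩
  exact det_of_generator hM hT

theorem mul_assoc_of_generator {M : Matrix (Fin 3) (Fin 3) Octonion} (hM : IsGenerator M)
    (X : H3) : M * (X.1 * Mᴴ) = M * X.1 * Mᴴ := by
  obtain ⟨s, N, hs, -, rfl⟩ := hM
  exact (map_ofComplex_mul_assoc hs N N X.1).symm

theorem exists_mem_TSL3 {M : Matrix (Fin 3) (Fin 3) Octonion} (hM : IsGenerator M) :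
    ∃ T ∈ TSL3, ∀ X : H3, (T X).1 = M * X.1 * Mᴴ := by
  obtain ⟨s, N, hs, hN, rfl⟩ := id hM
  have hu : IsUnit N.det := by rcases hN with h | h <;> simp [h]
  refine ⟨LinearEquiv.ofLinearMap (sandwich hs N) (sandwich hs N⁻¹) ?_ ?_, ?_, fun X => rfl⟩
  · ext1 X
    simp [← sandwich_mul, Matrix.mul_nonsing_inv _ hu, sandwich_one]
  · ext1 X
    simp [← sandwich_mul, Matrix.nonsing_inv_mul _ hu, sandwich_one]
  · exact Subgroup.subset_closure ⟨_, hM, fun X => rfl⟩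

/-! ### Rank-one Jordan matrices -/

theorem sigma_eq (X : H3) : sigma X = (hermTrace X ^ 2 - hermTrace (jordan X X)) / 2 := by
  simp only [sigma, freudenthal, hermTrace_sub, hermTrace_add, hermTrace_smul, hermTrace_one]
  ring

theorem hermTrace_freudenthal (X Y : H3) :
    hermTrace (freudenthal X Y) = (hermTrace X * hermTrace Y - hermTrace (jordan X Y)) / 2 := by
  simp only [freudenthal, hermTrace_sub, hermTrace_add, hermTrace_smul, hermTrace_one]
  ring

theorem freudenthal_self (X : H3) :
    freudenthal X X = jordan X X - hermTrace X • X + sigma X • one := by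
  rw [sigma_eq, freudenthal]
  module

theorem eq_zero_of_freudenthal_self {X : H3} (h : freudenthal X X = 0) (ht : hermTrace X = 0) :
    X = 0 := by
  apply eq_zero_of_hermTrace_jordan_self
  have h1 := sigma_eq X
  rw [sigma, h, hermTrace_zero, ht] at h1
  linarith

/-- On singular Jordan matrices `σ(X) = 0` already forces `X * X = 0`: the adjoint `Q = X * X`
satisfies `Q * Q = 0` and `tr Q = 0`, hence `tr (Q ∘ Q) = 0`. -/
theorem sigma_eq_zero_iff {X : H3} (hX : det X = 0) : sigma X = 0 ↔ freudenthal X X = 0 := by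
  refine ⟨fun h => eq_zero_of_freudenthal_self ?_ h, fun h => by rw [sigma, h, hermTrace_zero]⟩
  rw [freudenthal_freudenthal_self, hX, zero_smul]

/-! ### Determinant-preserving maps -/

/-- The polar form of the determinant, recovered from values of the determinant alone. -/
theorem hermTrace_triple_self (X Y : H3) :
    hermTrace (triple X X Y) = (det (X + Y) - det (X - Y)) / 2 - det Y := by
  have h1 : hermTrace (triple X Y X) = hermTrace (triple X X Y) := hermTrace_triple_right_comm _ _ _
  simp only [triple] at h1 ⊢
  simp only [det, triple, sub_eq_add_neg, ← neg_one_smul ℝ Y, add_freudenthal, freudenthal_add,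
    smul_freudenthal, freudenthal_smul, add_jordan, jordan_add, smul_jordan, jordan_smul,
    hermTrace_add, hermTrace_smul, freudenthal_comm Y X]
  linear_combination (-2 / 3 : ℝ) * h1

/-- `T` preserves the polar form `tr ((X * X) ∘ Y)` of the determinant, so `(T X) * (T X)` is
orthogonal to the range of `T`, which is everything, as soon as `X * X = 0`. -/
theorem freudenthal_self_eq_zero_of_map {T : H3 ≃ₗ[ℝ] H3} (hT : T ∈ E6) {X : H3}
    (h : freudenthal X X = 0) : freudenthal (T X) (T X) = 0 := by
  have hdet (Y : H3) : det (T Y) = det Y := hT Y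
  apply eq_zero_of_hermTrace_jordan_self
  obtain ⟨Y, hY⟩ := T.surjective (freudenthal (T X) (T X))
  nth_rewrite 2 [← hY]
  change hermTrace (triple (T X) (T X) (T Y)) = 0
  rw [hermTrace_triple_self, ← map_add, ← map_sub, hdet, hdet, hdet, ← hermTrace_triple_self,
    triple, h, zero_jordan, hermTrace_zero]

theorem freudenthal_map_self_eq_zero_iff {T : H3 ≃ₗ[ℝ] H3} (hT : T ∈ E6) (X : H3) :
    freudenthal (T X) (T X) = 0 ↔ freudenthal X X = 0 := by
  refine ⟨fun h => ?_, freudenthal_self_eq_zero_of_map hT⟩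
  have := freudenthal_self_eq_zero_of_map (inv_mem hT) h
  rwa [show (T⁻¹ : H3 ≃ₗ[ℝ] H3) (T X) = X from T.symm_apply_apply X] at this

/-! ### Idempotents of trace one -/

/-- Idempotents of trace one. These turn out to be the primitive idempotents. -/
def IsTraceOneIdempotent (P : H3) : Prop := jordan P P = P ∧ hermTrace P = 1

theorem IsTraceOneIdempotent.freudenthal_self {P : H3} (h : IsTraceOneIdempotent P) :
    freudenthal P P = 0 := by
  rw [H3.freudenthal_self, sigma_eq, h.1, h.2]
  module

theorem IsTraceOneIdempotent.ne_zero {P : H3} (h : IsTraceOneIdempotent P) : P ≠ 0 := by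
  rintro rfl
  simpa using h.2

theorem isTraceOneIdempotent_inv_smul {Q : H3} (h : freudenthal Q Q = 0)
    (ht : hermTrace Q ≠ 0) : IsTraceOneIdempotent ((hermTrace Q)⁻¹ • Q) := by
  have h1 := freudenthal_self Q
  rw [sigma, h, hermTrace_zero, zero_smul, add_zero, eq_comm, sub_eq_zero] at h1
  constructor
  · rw [jordan_smul, smul_jordan, h1, smul_smul, smul_smul, inv_mul_cancel_right₀ ht]
  · rw [hermTrace_smul, inv_mul_cancel₀ ht]

theorem isTraceOneIdempotent_diagonal : IsTraceOneIdempotent (mk 1 0 0 0 0 0) ∧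
    IsTraceOneIdempotent (mk 0 1 0 0 0 0) ∧ IsTraceOneIdempotent (mk 0 0 1 0 0 0) := by
  simp [IsTraceOneIdempotent, jordan_mk, hermTrace_mk]

/-- Every idempotent of trace one has an orthogonal one. With `E` a diagonal matrix unit, the
Freudenthal product `Q * E` satisfies `(Q * E) * (Q * E) = 0` and `Q ∘ (Q * E) = 0`, as is seen by
applying the adjoint identity and the characteristic equation to `Q ± E`. -/
theorem IsTraceOneIdempotent.exists_orthogonal {Q : H3} (hQ : IsTraceOneIdempotent Q) :
    ∃ R, IsTraceOneIdempotent R ∧ jordan Q R = 0 := by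
  obtain ⟨E, hE, hne⟩ : ∃ E, IsTraceOneIdempotent E ∧ hermTrace (jordan Q E) ≠ 1 := by
    obtain ⟨h1, h2, h3⟩ := isTraceOneIdempotent_diagonal
    by_contra! hc
    have e1 := hc _ h1
    have e2 := hc _ h2
    have e3 := hc _ h3
    have ht := hQ.2
    rw [eq_mk Q] at e1 e2 e3 ht
    simp only [hermTrace_jordan_mk, hermTrace_mk, star_zero, mul_zero, re_zero, mul_one] at *
    linarith
  have hQ0 := hQ.freudenthal_self
  have hE0 := hE.freudenthal_self
  have hp : freudenthal (Q + E) (Q + E) = (2 : ℝ) • freudenthal Q E := by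
    rw [add_freudenthal, freudenthal_add, freudenthal_add, hQ0, hE0, freudenthal_comm E Q]
    module
  have hm : freudenthal (Q + (-1 : ℝ) • E) (Q + (-1 : ℝ) • E) = (-2 : ℝ) • freudenthal Q E := by
    simp only [add_freudenthal, freudenthal_add, smul_freudenthal, freudenthal_smul, hQ0, hE0,
      freudenthal_comm E Q]
    module
  have hQE : hermTrace (jordan (freudenthal Q E) Q) = 0 := by
    have := hermTrace_triple_right_comm Q Q E
    rw [triple, hQ0, zero_jordan, hermTrace_zero] at this
    exact this.symm
  have hEQ : hermTrace (jordan (freudenthal Q E) E) = 0 := by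
    have := hermTrace_triple_right_comm E E Q
    rw [triple, hE0, zero_jordan, hermTrace_zero, triple, freudenthal_comm] at this
    exact this.symm
  have hdp : det (Q + E) = 0 := by
    rw [det, triple, hp, smul_jordan, jordan_add, hermTrace_smul, hermTrace_add, hQE, hEQ]
    ring
  have hdm : det (Q + (-1 : ℝ) • E) = 0 := by
    rw [det, triple, hm, smul_jordan, jordan_add, hermTrace_smul, hermTrace_add, jordan_smul,
      hermTrace_smul, hQE, hEQ]
    ring
  have hadj : freudenthal (freudenthal Q E) (freudenthal Q E) = 0 := by
    have h := freudenthal_freudenthal_self (Q + E)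
    rw [hdp, hp, freudenthal_smul, smul_freudenthal, zero_smul, smul_smul] at h
    exact (smul_eq_zero.1 h).resolve_left (by norm_num)
  have hort : jordan Q (freudenthal Q E) = 0 := by
    have h1 := jordan_freudenthal_self (Q + E)
    have h2 := jordan_freudenthal_self (Q + (-1 : ℝ) • E)
    rw [hdp, hp, zero_smul, smul_jordan, jordan_add] at h1
    rw [hdm, hm, zero_smul, smul_jordan, jordan_add, jordan_smul] at h2
    rw [jordan_comm]
    linear_combination (norm := module) (1 / 4 : ℝ) • h1 - (1 / 4 : ℝ) • h2
  have ht : hermTrace (freudenthal Q E) ≠ 0 := by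
    rw [hermTrace_freudenthal, hQ.2, hE.2]
    intro h
    apply hne
    linarith
  exact ⟨_, isTraceOneIdempotent_inv_smul hadj ht, by rw [jordan_smul, hort, smul_zero]⟩

theorem IsTraceOneIdempotent.complement {P R : H3} (hP : IsTraceOneIdempotent P)
    (hR : IsTraceOneIdempotent R) (h : jordan P R = 0) :
    IsTraceOneIdempotent (one - P - R) ∧ jordan P (one - P - R) = 0 ∧
      jordan R (one - P - R) = 0 := by
  have h' : jordan R P = 0 := by rw [jordan_comm, h]
  refine ⟨⟨?_, ?_⟩, ?_, ?_⟩
  · simp only [jordan_sub, sub_jordan, jordan_one, one_jordan, hP.1, hR.1, h, h']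
    module
  · rw [hermTrace_sub, hermTrace_sub, hermTrace_one, hP.2, hR.2]
    norm_num
  · simp [jordan_sub, hP.1, h]
  · simp [jordan_sub, hR.1, h']

theorem jordan_one_sub_self {E : H3} (hE : jordan E E = E) :
    jordan (one - E) (one - E) = one - E := by
  simp [jordan_sub, sub_jordan, hE]

theorem eq_zero_of_idempotent {E : H3} (hE : jordan E E = E) (ht : hermTrace E = 0) : E = 0 :=
  eq_zero_of_hermTrace_jordan_self (by rw [hE, ht])

/-- By the characteristic equation an idempotent either is a multiple of the identity or has a
trace `t` with `(t - 1) (t - 2) = 0`. -/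
theorem hermTrace_of_idempotent {E : H3} (hE : jordan E E = E) :
    hermTrace E = 0 ∨ hermTrace E = 1 ∨ hermTrace E = 2 ∨ hermTrace E = 3 := by
  have h := jordan_freudenthal_self E
  rw [freudenthal_self, sigma_eq, hE, add_jordan, sub_jordan, smul_jordan, smul_jordan, hE,
    one_jordan] at h
  set t := hermTrace E with ht
  have h1 : ((t - 1) * (t - 2)) • E = (2 * det E) • one := by
    linear_combination (norm := module) (2 : ℝ) • h
  by_cases hk : (t - 1) * (t - 2) = 0
  · rcases mul_eq_zero.1 hk with h2 | h2
    · right; left; linarith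
    · right; right; left; linarith
  · obtain ⟨c, hc⟩ : ∃ c : ℝ, E = c • one :=
      ⟨((t - 1) * (t - 2))⁻¹ * (2 * det E), by rw [mul_smul, ← h1, inv_smul_smul₀ hk]⟩
    have h2 : t = c * 3 := by rw [ht, hc, hermTrace_smul, hermTrace_one]
    have h3 := congrArg hermTrace hE
    rw [hc, smul_jordan, jordan_smul, jordan_one] at h3
    simp only [hermTrace_smul, hermTrace_one] at h3
    have h4 : c * (c - 1) = 0 := by linarith
    rcases mul_eq_zero.1 h4 with h5 | h5
    · left; rw [h2, h5, zero_mul]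
    · right; right; right; linarith

theorem isPrimitiveIdempotent_iff (P : H3) :
    IsPrimitiveIdempotent P ↔ IsTraceOneIdempotent P := by
  constructor
  · rintro ⟨h0, hP, hsplit⟩
    refine ⟨hP, ?_⟩
    rcases hermTrace_of_idempotent hP with h | h | h | h
    · exact absurd (eq_zero_of_idempotent hP h) h0
    · exact h
    · have hQ : IsTraceOneIdempotent (one - P) :=
        ⟨jordan_one_sub_self hP, by rw [hermTrace_sub, hermTrace_one, h]; norm_num⟩
      obtain ⟨R, hR, hQR⟩ := hQ.exists_orthogonal
      obtain ⟨hS, -, hRS⟩ := hQ.complement hR hQR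
      rcases hsplit R _ hR.1 hS.1 hRS (by abel) with h1 | h1
      · exact absurd h1 hR.ne_zero
      · exact absurd h1 hS.ne_zero
    · have h1 : one - P = 0 := eq_zero_of_idempotent (jordan_one_sub_self hP)
        (by rw [hermTrace_sub, hermTrace_one, h]; norm_num)
      have hE := isTraceOneIdempotent_diagonal.1
      set E := mk 1 0 0 0 0 0
      rcases hsplit E (one - E) hE.1 (jordan_one_sub_self hE.1)
        (by rw [jordan_sub, jordan_one, hE.1, sub_self])
        (by rw [add_sub_cancel]; exact (sub_eq_zero.1 h1).symm) with h2 | h2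
      · exact absurd h2 hE.ne_zero
      · have h3 := congrArg hermTrace h2
        rw [hermTrace_sub, hermTrace_one, hE.2, hermTrace_zero] at h3
        norm_num at h3
  · intro hP
    refine ⟨hP.ne_zero, hP.1, fun E F hE hF _ hPEF => ?_⟩
    have h1 := hP.2
    rw [hPEF, hermTrace_add] at h1
    rcases hermTrace_of_idempotent hE with h | h | h | h
    · exact Or.inl (eq_zero_of_idempotent hE h)
    · exact Or.inr (eq_zero_of_idempotent hF (by linarith))
    all_goals
      have h2 := hermTrace_jordan_self_nonneg F
      rw [hF] at h2
      linarith

/-! ### The spectral theorem -/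

theorem det_sub_smul_one (X : H3) (t : ℝ) :
    det (X - t • one) = det X - t * sigma X + t ^ 2 * hermTrace X - t ^ 3 := by
  obtain ⟨a, b, c, x, y, z, rfl⟩ := exists_mk X
  rw [sigma, freudenthal_self_mk, one_eq_mk, smul_mk, mk_sub, det_mk, det_mk, hermTrace_mk,
    hermTrace_mk]
  simp only [smul_zero, sub_zero]
  ring

theorem exists_cubic_root (p q r : ℝ) : ∃ t : ℝ, r - t * q + t ^ 2 * p - t ^ 3 = 0 := by
  have hc : Continuous fun t : ℝ => r - t * q + t ^ 2 * p - t ^ 3 := by fun_prop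
  -- a Cauchy bound for the absolute values of the roots
  set M := 1 + |p| + |q| + |r| with hM
  have hp := abs_le.1 (le_refl |p|)
  have hq := abs_le.1 (le_refl |q|)
  have hr := abs_le.1 (le_refl |r|)
  have hM1 : 1 ≤ M := by linarith [abs_nonneg p, abs_nonneg q, abs_nonneg r]
  have hM2 : M ≤ M ^ 2 := by nlinarith
  have hpM : M ^ 2 * |p| + M * |q| + |r| < M ^ 3 := by
    have h1 : M * |q| ≤ M ^ 2 * |q| := mul_le_mul_of_nonneg_right hM2 (abs_nonneg q)
    have h2 : |r| ≤ M ^ 2 * |r| := le_mul_of_one_le_left (abs_nonneg r) (by linarith)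
    have h3 : M ^ 3 = M ^ 2 * |p| + M ^ 2 * |q| + M ^ 2 * |r| + M ^ 2 := by rw [hM]; ring
    linarith
  have hpp := mul_le_mul_of_nonneg_left hp.1 (sq_nonneg M)
  have hpp' := mul_le_mul_of_nonneg_left hp.2 (sq_nonneg M)
  have hqq := mul_le_mul_of_nonneg_left hq.1 (by linarith : 0 ≤ M)
  have hqq' := mul_le_mul_of_nonneg_left hq.2 (by linarith : 0 ≤ M)
  obtain ⟨t, -, ht⟩ := intermediate_value_Icc' (by linarith : -M ≤ M) hc.continuousOn
    (show (0 : ℝ) ∈ _ from ⟨by linarith [hr.2], by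
      have : -M ^ 3 = (-M) ^ 3 := by ring
      nlinarith [hr.1]⟩)
  exact ⟨t, ht⟩

/-- The spectral theorem. Subtracting a real eigenvalue gives a singular matrix `B`. Either
`B * B = 0`, and `B` is a multiple of an idempotent `P` of trace one, or `P` is the normalized
`B * B`; then `P ∘ B = 0`, and `B` satisfies a quadratic equation on the Peirce space of `P` with
unit `1 - P`. -/
theorem exists_spectral_decomposition (A : H3) : ∃ (P R : H3) (α β γ : ℝ),
    IsTraceOneIdempotent P ∧ IsTraceOneIdempotent R ∧ jordan P R = 0 ∧
      A = α • P + β • R + γ • (one - P - R) := by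
  obtain ⟨t, ht⟩ := exists_cubic_root (hermTrace A) (sigma A) (det A)
  rw [← det_sub_smul_one] at ht
  obtain ⟨B, hB⟩ : ∃ B, B = A - t • one := ⟨_, rfl⟩
  have hA : A = B + t • one := by rw [hB, sub_add_cancel]
  rw [← hB] at ht
  rw [hA]
  have hadj : freudenthal (freudenthal B B) (freudenthal B B) = 0 := by
    rw [freudenthal_freudenthal_self, ht, zero_smul]
  by_cases h0 : freudenthal B B = 0
  · -- `B` is a multiple of an idempotent of trace one
    obtain ⟨Q, τ, hQ, hBQ⟩ : ∃ (Q : H3) (τ : ℝ), IsTraceOneIdempotent Q ∧ B = τ • Q := by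
      by_cases hτ : hermTrace B = 0
      · exact ⟨_, 0, isTraceOneIdempotent_diagonal.1, by
          rw [zero_smul, eq_zero_of_freudenthal_self h0 hτ]⟩
      · exact ⟨_, hermTrace B, isTraceOneIdempotent_inv_smul h0 hτ, (smul_inv_smul₀ hτ B).symm⟩
    obtain ⟨R, hR, hQR⟩ := hQ.exists_orthogonal
    exact ⟨Q, R, t + τ, t, t, hQ, hR, hQR, by rw [hBQ]; module⟩
  · obtain ⟨μ, hμ⟩ : ∃ μ, μ = sigma B := ⟨_, rfl⟩
    obtain ⟨τ, hτ⟩ : ∃ τ, τ = hermTrace B := ⟨_, rfl⟩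
    have hμ' : hermTrace (freudenthal B B) = μ := hμ.symm
    have hμ0 : μ ≠ 0 := fun h => h0 (eq_zero_of_freudenthal_self hadj (hμ'.trans h))
    have hP := isTraceOneIdempotent_inv_smul hadj (hμ' ▸ hμ0)
    rw [hμ'] at hP
    obtain ⟨P, hPdef⟩ : ∃ P, P = μ⁻¹ • freudenthal B B := ⟨_, rfl⟩
    rw [← hPdef] at hP
    have hPB : jordan P B = 0 := by
      rw [hPdef, smul_jordan, jordan_freudenthal_self, ht, zero_smul, smul_zero]
    have hBP : jordan B P = 0 := by rw [jordan_comm, hPB]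
    have hBB : jordan B B = τ • B - μ • (one - P) := by
      have h := freudenthal_self B
      rw [← hμ, ← hτ] at h
      have h2 : μ • P = freudenthal B B := by rw [hPdef, smul_inv_smul₀ hμ0]
      linear_combination (norm := module) -h - h2
    have htr : hermTrace (jordan B B) = τ ^ 2 - 2 * μ := by
      rw [hBB, hermTrace_sub, hermTrace_smul, hermTrace_smul, hermTrace_sub, hermTrace_one, hP.2,
        ← hτ]
      ring
    -- the Cauchy–Schwarz inequality for `B` and `1 - P` makes the discriminant nonnegative
    have hself : hermTrace (jordan ((2 : ℝ) • B - τ • (one - P)) ((2 : ℝ) • B - τ • (one - P))) =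
        2 * (τ ^ 2 - 4 * μ) := by
      simp only [jordan_sub, sub_jordan, jordan_smul, smul_jordan, jordan_one, one_jordan, hPB, hBP,
        hP.1, hermTrace_sub, hermTrace_smul, htr, hermTrace_one, hP.2, hermTrace_zero, ← hτ]
      ring
    have hD : 0 ≤ τ ^ 2 - 4 * μ := by
      have := hermTrace_jordan_self_nonneg ((2 : ℝ) • B - τ • (one - P))
      linarith
    rcases hD.eq_or_lt with hD0 | hD0
    · have h1 : (2 : ℝ) • B - τ • (one - P) = 0 :=
        eq_zero_of_hermTrace_jordan_self (by rw [hself, ← hD0, mul_zero])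
      obtain ⟨R, hR, hPR⟩ := hP.exists_orthogonal
      refine ⟨P, R, t, t + τ / 2, t + τ / 2, hP, hR, hPR, ?_⟩
      linear_combination (norm := module) (1 / 2 : ℝ) • h1
    · obtain ⟨δ, hδ, hδ2⟩ : ∃ δ : ℝ, 0 < δ ∧ δ ^ 2 = τ ^ 2 - 4 * μ :=
        ⟨√(τ ^ 2 - 4 * μ), Real.sqrt_pos.2 hD0, Real.sq_sqrt hD⟩
      have hδ0 : δ ≠ 0 := hδ.ne'
      -- the smaller eigenvalue of `B` on the Peirce space of `P`
      obtain ⟨r, hr⟩ : ∃ r : ℝ, r = (τ - δ) / 2 := ⟨_, rfl⟩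
      obtain ⟨R, hRdef⟩ : ∃ R, R = δ⁻¹ • (B - r • (one - P)) := ⟨_, rfl⟩
      have hδR : δ • R = B - r • (one - P) := by rw [hRdef, smul_inv_smul₀ hδ0]
      have hR : IsTraceOneIdempotent R := by
        constructor
        · have h1 : (δ * δ) • jordan R R = (δ * δ) • R := by
            have h2 : (δ * δ) • jordan R R = jordan (δ • R) (δ • R) := by
              rw [smul_jordan, jordan_smul, smul_smul]
            have h3 : r ^ 2 - μ = -δ * r := by
              rw [hr]
              linear_combination (-1 / 4 : ℝ) * hδ2
            have h4 : τ = δ + 2 * r := by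
              rw [hr]
              ring
            rw [h2, mul_smul, hδR]
            simp only [jordan_sub, sub_jordan, jordan_smul, smul_jordan, jordan_one, one_jordan,
              hPB, hBP, hP.1, hBB]
            rw [h4]
            linear_combination (norm := module) h3 • (one - P)
          exact smul_right_injective _ (mul_ne_zero hδ0 hδ0) h1
        · rw [hRdef, hermTrace_smul, hermTrace_sub, hermTrace_smul, hermTrace_sub, hermTrace_one,
            hP.2, ← hτ, hr]
          field_simp
          ring
      have hPR : jordan P R = 0 := by
        rw [hRdef, jordan_smul, jordan_sub, jordan_smul, jordan_sub, hPB, jordan_one, hP.1]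
        simp
      refine ⟨P, R, t, t + δ + r, t + r, hP, hR, hPR, ?_⟩
      linear_combination (norm := module) -hδR

/-! ### Rank and `p`-squares -/

theorem exists_isPSquare (A : H3) : ∃ p, IsPSquare p A := by
  obtain ⟨P, R, α, β, γ, hP, hR, hPR, hA⟩ := exists_spectral_decomposition A
  obtain ⟨hS, hPS, hRS⟩ := hP.complement hR hPR
  refine ⟨_, ![α, β, γ], ![P, R, one - P - R], ?_, ?_, ?_, rfl⟩
  · intro i
    rw [isPrimitiveIdempotent_iff]
    fin_cases i
    exacts [hP, hR, hS]
  · intro i j hij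
    fin_cases i <;> fin_cases j
    exacts [absurd rfl hij, hPR, hPS, (jordan_comm _ _).trans hPR, absurd rfl hij, hRS,
      (jordan_comm _ _).trans hPS, (jordan_comm _ _).trans hRS, absurd rfl hij]
  · rw [hA, Fin.sum_univ_three]
    rfl

/-- The vanishing of `A`, of `A * A` and of `det A` says that at most zero, one, or two
eigenvalues of `A` are nonzero, so together they determine the `p` for which `A` is a `p`-square. -/
theorem IsPSquare.rank_conditions {p : ℕ} {A : H3} (h : IsPSquare p A) :
    p ≤ 3 ∧ (A = 0 ↔ p = 0) ∧ (freudenthal A A = 0 ↔ p ≤ 1) ∧ (det A = 0 ↔ p ≤ 2) := by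
  obtain ⟨lam, Q, hQ, hort, hA, hcard⟩ := h
  simp only [isPrimitiveIdempotent_iff] at hQ
  have hP := hQ 0
  have hR := hQ 1
  have hS := hQ 2
  have hPR := hort 0 1 (by decide)
  have hPS := hort 0 2 (by decide)
  have hRS := hort 1 2 (by decide)
  rw [Fin.sum_univ_three] at hA
  rw [Finset.card_filter, Fin.sum_univ_three] at hcard
  generalize Q 0 = P at hP hPR hPS hA
  generalize Q 1 = R at hR hPR hRS hA
  generalize Q 2 = S at hS hPS hRS hA
  generalize lam 0 = α at hA hcard
  generalize lam 1 = β at hA hcard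
  generalize lam 2 = γ at hA hcard
  have hRP : jordan R P = 0 := by rw [jordan_comm, hPR]
  have hSP : jordan S P = 0 := by rw [jordan_comm, hPS]
  have hSR : jordan S R = 0 := by rw [jordan_comm, hRS]
  -- three orthogonal idempotents of trace one add up to the identity
  have hone : one = P + R + S := by
    apply sub_eq_zero.1
    apply eq_zero_of_hermTrace_jordan_self
    simp only [jordan_sub, sub_jordan, jordan_add, add_jordan, jordan_one, one_jordan, hP.1, hR.1,
      hS.1, hPR, hPS, hRS, hRP, hSP, hSR, hermTrace_sub, hermTrace_add, hermTrace_one, hP.2, hR.2,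
      hS.2, hermTrace_zero]
    norm_num
  have hcoef {a b c : ℝ} : a • P + b • R + c • S = 0 ↔ a = 0 ∧ b = 0 ∧ c = 0 := by
    refine ⟨fun h => ?_, fun ⟨ha, hb, hc⟩ => by simp [ha, hb, hc]⟩
    have h1 := congrArg (fun X => hermTrace (jordan P X)) h
    have h2 := congrArg (fun X => hermTrace (jordan R X)) h
    have h3 := congrArg (fun X => hermTrace (jordan S X)) h
    simp only [jordan_add, jordan_smul, hP.1, hR.1, hS.1, hPR, hPS, hRS, hRP, hSP, hSR,
      hermTrace_add, hermTrace_smul, hP.2, hR.2, hS.2, hermTrace_zero, jordan_zero] at h1 h2 h3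
    exact ⟨by linarith, by linarith, by linarith⟩
  have hadj : freudenthal A A = (β * γ) • P + (α * γ) • R + (α * β) • S := by
    rw [hA, freudenthal_self, sigma_eq, hone]
    simp only [jordan_add, add_jordan, jordan_smul, smul_jordan, hP.1, hR.1,
      hS.1, hPR, hPS, hRS, hRP, hSP, hSR, hermTrace_add, hermTrace_smul, hP.2, hR.2,
      hS.2, hermTrace_zero]
    module
  have hdet : det A = α * β * γ := by
    rw [det, triple, hadj, hA]
    simp only [jordan_add, add_jordan, jordan_smul, smul_jordan, hP.1, hR.1,
      hS.1, hPR, hPS, hRS, hRP, hSP, hSR, hermTrace_add, hermTrace_smul, hP.2, hR.2,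
      hS.2, hermTrace_zero]
    ring
  rw [hdet, hadj, hcoef, hA, hcoef, ← hcard]
  by_cases hα : α = 0 <;> by_cases hβ : β = 0 <;> by_cases hγ : γ = 0 <;> simp [hα, hβ, hγ]

/-- As every Jordan matrix is a `p`-square for some `p`, the rank conditions characterize
`p`-squares. -/
theorem IsPSquare.congr {p : ℕ} {A B : H3} (h : IsPSquare p A) (h0 : A = 0 ↔ B = 0)
    (h1 : freudenthal A A = 0 ↔ freudenthal B B = 0) (h2 : det A = 0 ↔ det B = 0) :
    IsPSquare p B := by
  obtain ⟨q, hq⟩ := exists_isPSquare B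
  obtain ⟨ha, ha0, ha1, ha2⟩ := h.rank_conditions
  obtain ⟨hb, hb0, hb1, hb2⟩ := hq.rank_conditions
  have : p = q := by
    rw [ha0, hb0] at h0
    rw [ha1, hb1] at h1
    rw [ha2, hb2] at h2
    omega
  rwa [this]

theorem isPSquare_map_iff {T : H3 ≃ₗ[ℝ] H3} (hT : T ∈ E6) (p : ℕ) (A : H3) :
    IsPSquare p (T A) ↔ IsPSquare p A := by
  have h0 : T A = 0 ↔ A = 0 := T.map_eq_zero_iff
  have h1 := freudenthal_map_self_eq_zero_iff hT A
  have h2 : det (T A) = 0 ↔ det A = 0 := by rw [show det (T A) = det A from hT A]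
  exact ⟨fun h => h.congr h0 h1 h2, fun h => h.congr h0.symm h1.symm h2.symm⟩

theorem isPSquare_one_iff (P : H3) : IsPSquare 1 P ↔ P ≠ 0 ∧ freudenthal P P = 0 := by
  constructor
  · intro h
    obtain ⟨-, h0, h1, -⟩ := h.rank_conditions
    exact ⟨fun h' => one_ne_zero (h0.1 h'), h1.2 le_rfl⟩
  · rintro ⟨hP, hPP⟩
    obtain ⟨p, hp⟩ := exists_isPSquare P
    obtain ⟨-, h0, h1, -⟩ := hp.rank_conditions
    have h2 : p ≠ 0 := fun h => hP (h0.2 h)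
    have h3 := h1.1 hPP
    rwa [show p = 1 by omega] at hp

/-! ### The Dirac equation -/

theorem ofBlocks_eq_mk (P : H2) (ψ : Fin 2 → Octonion) (n : ℝ) :
    ofBlocks P ψ n = mk (P.1 0 0).re (P.1 1 1).re n (P.1 0 1) (ψ 1) (star (ψ 0)) := by
  rw [eq_mk (ofBlocks P ψ n)]
  simp [ofBlocks]

theorem traceReversal_mulVec_eq_zero_iff (P : H2) (ψ : Fin 2 → Octonion) :
    traceReversal P *ᵥ ψ = 0 ↔ P.1 0 1 * ψ 1 = (P.1 1 1).re • ψ 0 ∧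
      star (P.1 0 1) * ψ 0 = (P.1 0 0).re • ψ 1 := by
  have hP : ∀ i j, star (P.1 i j) = P.1 j i := fun i j => by
    have h : P.1ᴴ = P.1 := P.2
    exact congrFun (congrFun h j) i
  have h00 := eq_re_smul_one (hP 0 0)
  have h11 := eq_re_smul_one (hP 1 1)
  have e0 : (traceReversal P *ᵥ ψ) 0 = P.1 0 1 * ψ 1 - (P.1 1 1).re • ψ 0 := by
    simp only [traceReversal, Matrix.mulVec, dotProduct, Fin.sum_univ_two, Matrix.sub_apply,
      Matrix.smul_apply, hermTrace, Matrix.one_apply, sub_mul, smul_mul_assoc]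
    rw [h00]
    simp
    module
  have e1 : (traceReversal P *ᵥ ψ) 1 = star (P.1 0 1) * ψ 0 - (P.1 0 0).re • ψ 1 := by
    simp only [traceReversal, Matrix.mulVec, dotProduct, Fin.sum_univ_two, Matrix.sub_apply,
      Matrix.smul_apply, hermTrace, Matrix.one_apply, sub_mul, smul_mul_assoc, hP]
    rw [h11]
    simp
    module
  rw [funext_iff, Fin.forall_fin_two, e0, e1, Pi.zero_apply, Pi.zero_apply, sub_eq_zero,
    sub_eq_zero]

/-- Two of the six equations `𝒫 * 𝒫 = 0`, namely those expressing the Dirac equation, imply the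
other four for a suitable diagonal entry `n`: alternativity gives `|x|² = a b`, and then
`n = (|u|² + |v|²) / (a + b)`. -/
theorem exists_freudenthal_eq_zero_of_dirac {a b : ℝ} {x u v : Octonion}
    (hP : ¬(a = 0 ∧ b = 0 ∧ x = 0))
    (hψ : ¬(u = 0 ∧ v = 0)) (h1 : x * v = b • u) (h2 : star x * u = a • v) :
    ∃ n : ℝ, freudenthal (mk a b n x v (star u)) (mk a b n x v (star u)) = 0 := by
  have hv : (normSq x - a * b) • v = 0 := by
    have h := star_mul_mul_self x v
    rw [h1, mul_smul_comm, h2] at h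
    rw [sub_smul, ← h]
    module
  have hu : (normSq x - a * b) • u = 0 := by
    have h := mul_star_mul_self x u
    rw [h2, mul_smul_comm, h1] at h
    rw [sub_smul, ← h]
    module
  have hx : normSq x = a * b := by
    by_contra hne
    have hne' := sub_ne_zero.2 hne
    exact hψ ⟨(smul_eq_zero.1 hu).resolve_left hne', (smul_eq_zero.1 hv).resolve_left hne'⟩
  have hab : a + b ≠ 0 := by
    intro h
    have hx0 := normSq_nonneg x
    have hb : b = -a := by linarith
    have ha : a = 0 := by
      rw [hx, hb] at hx0
      nlinarith
    refine hP ⟨ha, by rw [hb, ha, neg_zero], normSq_eq_zero.1 ?_⟩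
    rw [hx, ha, zero_mul]
  have n1 : a * b * normSq v = b ^ 2 * normSq u := by
    rw [← hx, ← normSq_mul, h1, normSq_smul]
  have n2 : a * b * normSq u = a ^ 2 * normSq v := by
    rw [← hx, ← normSq_star x, ← normSq_mul, h2, normSq_smul]
  -- as `a + b ≠ 0`, the two norm equations say that `ψ` has squared entries in the ratio `a : b`
  have hk : a * normSq v = b * normSq u := by
    apply mul_left_cancel₀ hab
    linarith
  refine ⟨(normSq u + normSq v) / (a + b), ?_⟩
  rw [freudenthal_self_mk, zero_eq_mk, mk_inj, normSq_star]
  refine ⟨?_, ?_, ?_, ?_, ?_, ?_⟩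
  · field_simp
    linear_combination -hk
  · field_simp
    linear_combination hk
  · rw [hx, sub_self]
  · have h3 : (a + b) • star (v * star u) = (normSq u + normSq v) • x := by
      have e1 : u * (star u * x) = normSq u • x := mul_star_mul_self u x
      have e2 : star u * x = a • star v := by
        have := congrArg star h2
        rwa [star_mul, star_star, star_smul, star_trivial a] at this
      rw [e2, mul_smul_comm] at e1
      have e3 := mul_mul_star_self v x
      rw [h1, smul_mul_assoc] at e3
      rw [star_mul, star_star, add_smul, e1, e3, add_smul]
    have h4 : (a + b) • (star (v * star u) - ((normSq u + normSq v) / (a + b)) • x) = 0 := by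
      rw [smul_sub, h3, smul_smul, mul_div_cancel₀ _ hab, sub_self]
    exact (smul_eq_zero.1 h4).resolve_left hab
  · rw [star_mul, star_star, h2, sub_self]
  · rw [h1, star_smul, star_trivial, sub_self]

theorem dirac_iff (P : H2) (ψ : Fin 2 → Octonion) (hP : P ≠ 0) (hψ : ψ ≠ 0) :
    traceReversal P *ᵥ ψ = 0 ↔
      ∃ n : ℝ, freudenthal (ofBlocks P ψ n) (ofBlocks P ψ n) = 0 := by
  have hPh : ∀ i j, star (P.1 i j) = P.1 j i := fun i j => by
    have h : P.1ᴴ = P.1 := P.2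
    exact congrFun (congrFun h j) i
  rw [traceReversal_mulVec_eq_zero_iff]
  simp only [ofBlocks_eq_mk]
  constructor
  · rintro ⟨h1, h2⟩
    refine exists_freudenthal_eq_zero_of_dirac ?_ ?_ h1 h2
    · rintro ⟨h00, h11, h01⟩
      apply hP
      have e0 := eq_re_smul_one (hPh 0 0)
      have e1 := eq_re_smul_one (hPh 1 1)
      rw [h00, zero_smul] at e0
      rw [h11, zero_smul] at e1
      have e2 := hPh 0 1
      rw [h01, star_zero] at e2
      apply Subtype.ext
      ext1 i j
      fin_cases i <;> fin_cases j
      exacts [e0, h01, e2.symm, e1]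
    · rintro ⟨h0, h1⟩
      apply hψ
      ext1 i
      fin_cases i
      exacts [h0, h1]
  · rintro ⟨n, hn⟩
    rw [freudenthal_self_mk, zero_eq_mk, mk_inj] at hn
    obtain ⟨-, -, -, -, h1, h2⟩ := hn
    rw [star_mul, star_star, sub_eq_zero] at h1
    have h3 := congrArg star (sub_eq_zero.1 h2)
    rw [star_star, star_smul, star_star, star_trivial] at h3
    exact ⟨h3, h1⟩

end H3

end

theorem mainTheorem3 :
    -- the generators `X ↦ M X M†` are well defined, and the group they generate lies in `E₆`
    (∀ M : Matrix (Fin 3) (Fin 3) Octonion, H3.IsGenerator M →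
      (∀ X : H3, M * (X.1 * Mᴴ) = (M * X.1) * Mᴴ) ∧
      ∃ T ∈ H3.TSL3, ∀ X : H3, (T X).1 = M * X.1 * Mᴴ) ∧
    H3.TSL3 ≤ H3.E6 ∧
    -- `E₆` preserves the determinant, the condition `σ = 0` on singular matrices, the `p`-squares
    -- for each `p`, and the solutions of the Dirac equation
    (∀ T ∈ H3.E6,
      (∀ A : H3, H3.det (T A) = H3.det A) ∧
      (∀ A : H3, H3.det A = 0 → (H3.sigma (T A) = 0 ↔ H3.sigma A = 0)) ∧
      (∀ (p : ℕ) (A : H3), H3.IsPSquare p (T A) ↔ H3.IsPSquare p A) ∧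
      (∀ P : H3, H3.freudenthal (T P) (T P) = 0 ↔ H3.freudenthal P P = 0)) ∧
    -- the nonzero solutions of the Dirac equation are exactly the `1`-squares
    (∀ P : H3, H3.IsPSquare 1 P ↔ P ≠ 0 ∧ H3.freudenthal P P = 0) ∧
    -- `𝒫 * 𝒫 = 0` expresses the 10-dimensional Dirac equation `P̃ ψ = 0`
    (∀ (P : H2) (ψ : Fin 2 → Octonion), P ≠ 0 → ψ ≠ 0 →
      (traceReversal P *ᵥ ψ = 0 ↔
        ∃ n : ℝ, H3.freudenthal (H3.ofBlocks P ψ n) (H3.ofBlocks P ψ n) = 0)) := by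
  refine ⟨fun M hM => ⟨H3.mul_assoc_of_generator hM, H3.exists_mem_TSL3 hM⟩, H3.TSL3_le_E6,
    fun T hT => ?_, H3.isPSquare_one_iff, H3.dirac_iff⟩
  have hdet (A : H3) : H3.det (T A) = H3.det A := hT A
  refine ⟨hdet, fun A hA => ?_, H3.isPSquare_map_iff hT, H3.freudenthal_map_self_eq_zero_iff hT⟩
  rw [H3.sigma_eq_zero_iff (by rw [hdet, hA]), H3.sigma_eq_zero_iff hA,
    H3.freudenthal_map_self_eq_zero_iff hT]
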